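/- Let $K$ be a finite field, let $S=K[t_1,\ldots,t_s]=\bigoplus_{d\ge 0}S_d$ have the standard grading, and let $\prec$ be the graded reverse lexicographic (GRevLex) order on $S$: $t^a\succ t^b$ if $\deg t^a>\deg t^b$, or $\deg t^a=\deg t^b$ and the last non-zero entry of $a-b$ is negative. Let $\mathbb{X}=\{[P_1],\ldots,[P_m]\}$ be a set of $m\geq 2$ distinct points of $\mathbb{P}^{s-1}$ over $K$ with fixed representatives $P_i\in K^s\setminus\{0\}$, let $I=I(\mathbb{X})$ be the ideal of $S$ generated by the homogeneous polynomials that vanish at all points of $\mathbb{X}$, and let $\mathfrak{p}_i$ be the vanishing ideal of $[P_i]$. Let $\Delta_\prec(I)$ be the set of standard monomials of $S/I$ (the monomials not in the initial ideal ${\rm in}_\prec(I)$), $\Delta_\prec(I)_d$ the set of those of degree $d$, and $K\Delta_\prec(I)$ the $K$-span of $\Delta_\prec(I)$. Let $b_{i,j}$ be the graded Betti numbers of the minimal graded free resolution of $S/I$, let $g$ be its length, and let $r_0={\rm reg}(S/I)=\max\{j-i\mid b_{i,j}\neq 0\}$. The ideal $I$ is Gorenstein if there is a unique $j$ with $b_{g,j}\neq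 0$ and, for this $j$, $b_{g,j}=1$. For each $i$ let $f_i$ be the $i$-th standard indicator function of $\mathbb{X}$: the homogeneous polynomial in $K\Delta_\prec(I)$ (unique up to a factor in $K^*=K\setminus\{0\}$) of degree ${\rm v}_{\mathfrak{p}_i}(I)=\min\{d\mid \exists f\in S_d,\ (I\colon f)=\mathfrak{p}_i\}$ with $f_i(P_i)\neq 0$ and $f_i(P_j)=0$ for $j\neq i$. Let ${\rm lc}(f_i)$ be its leading coefficient. A standard monomial is essential if it appears in every $f_i$. Let $C_\mathbb{X}(d)=\{(f(P_1),\ldots,f(P_m))\mid f\in S_d\}\subset K^m$. Suppose that $t_s$ is regular (a non-zero-divisor) on $S/I$ and that $I$ is Gorenstein. Then: (a) There is $t^a\in\Delta_\prec(I)_{r_0}$ such that $t_s$ does not divide $t^a$ and every $f_i$ has the form $f_i=\lambda_i t^a+t_sG_i$ for some $\lambda_i\in K^*$ and $G_i\in S_{r_0-1}$. In particular, $t^a$ is essential and $\lambda_i={\rm lc}(f_i)$. (b) If $t_s(P_i)=1$ for all $i$, then the $1\times m$ matrix $H=({\rm lc}(f_1)f_1(P_1)^{-1},\ldots,{\rm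 lc}(f_m)f_m(P_m)^{-1})$ is a parity check matrix of $C_\mathbb{X}(r_0-1)$, that is, the row of $H$ is linearly independent (non-zero) and $C_\mathbb{X}(r_0-1)=\{x\in K^m\mid Hx=0\}$. -/

import Mathlib

open MvPolynomial

/-! ### The graded reverse lexicographic order

The variables `t_1, …, t_s` are indexed by `Fin (n + 1)`, so that `s = n + 1` and the last variable
`t_s` is `X (Fin.last n)`. -/

/-- Exponent vectors of monomials in `n + 1` variables, to be ordered by GRevLex. -/
def GRevLexExp (n : ℕ) : Type := Fin (n + 1) →₀ ℕ

namespace GRevLexExp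

variable {n : ℕ}

noncomputable instance : AddCommMonoid (GRevLexExp n) :=
  inferInstanceAs (AddCommMonoid (Fin (n + 1) →₀ ℕ))

/-- The tuple of partial sums `(a_1 + ⋯ + a_s, a_1 + ⋯ + a_{s-1}, …, a_1)`. Comparing these tuples
lexicographically is GRevLex, see `MonomialOrder.grevLex_lt_iff`. -/
noncomputable def key (a : Fin (n + 1) →₀ ℕ) : Lex (Fin (n + 1) → ℕ) :=
  toLex fun k => ∑ i ∈ Finset.Iic (Fin.rev k), a i

theorem key_apply (a : Fin (n + 1) →₀ ℕ) (k : Fin (n + 1)) :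
    key a k = ∑ i ∈ Finset.Iic (Fin.rev k), a i := rfl

theorem key_add (a b : Fin (n + 1) →₀ ℕ) : key (a + b) = key a + key b := by
  funext k
  exact Finset.sum_add_distrib (s := Finset.Iic (Fin.rev k)) (f := a) (g := b)

theorem key_zero_eq_degree (a : Fin (n + 1) →₀ ℕ) : key a 0 = a.degree := by
  have h : Finset.Iic (Fin.rev (0 : Fin (n + 1))) = Finset.univ := by
    ext i
    simp [Fin.le_last]
  rw [key_apply, h, Finsupp.degree_eq_sum]

theorem key_castSucc (a : Fin (n + 1) →₀ ℕ) (k : Fin n) :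
    key a k.castSucc = key a k.succ + a (Fin.rev k.castSucc) := by
  have h : Finset.Iic (Fin.rev k.castSucc)
      = insert (Fin.rev k.castSucc) (Finset.Iic (Fin.rev k.succ)) := by
    ext i
    simp only [Finset.mem_Iic, Finset.mem_insert, Fin.le_def, Fin.ext_iff, Fin.val_rev,
      Fin.val_castSucc, Fin.val_succ]
    omega
  have h' : Fin.rev k.castSucc ∉ Finset.Iic (Fin.rev k.succ) := by
    simp only [Finset.mem_Iic, Fin.le_def, Fin.val_rev, Fin.val_castSucc, Fin.val_succ]
    omega
  rw [key_apply, h, Finset.sum_insert h', key_apply, add_comm]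

theorem key_last (a : Fin (n + 1) →₀ ℕ) : key a (Fin.last n) = a 0 := by
  have h : Finset.Iic (Fin.rev (Fin.last n)) = {0} := by
    ext i
    simp
  rw [key_apply, h, Finset.sum_singleton]

theorem key_injective : Function.Injective (key (n := n)) := by
  intro a b h
  ext i
  rcases Fin.eq_zero_or_eq_succ i with rfl | ⟨j, rfl⟩
  · rw [← key_last, ← key_last, h]
  · have e : (j.succ : Fin (n + 1)) = Fin.rev (Fin.rev j).castSucc := by
      rw [Fin.rev_castSucc, Fin.rev_rev]
    have ha := key_castSucc a (Fin.rev j)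
    have hb := key_castSucc b (Fin.rev j)
    rw [e]
    rw [h] at ha
    omega

noncomputable instance : LinearOrder (GRevLexExp n) :=
  LinearOrder.lift' (key (n := n)) key_injective

theorem lt_iff_key {a b : GRevLexExp n} : a < b ↔ key (n := n) a < key (n := n) b := Iff.rfl

theorem le_iff_key {a b : GRevLexExp n} : a ≤ b ↔ key (n := n) a ≤ key (n := n) b := Iff.rfl

instance : IsOrderedAddMonoid (GRevLexExp n) where
  add_le_add_left a b h c := by
    rw [le_iff_key] at h ⊢
    have e (x y : GRevLexExp n) : key (n := n) (x + y) = key (n := n) x + key (n := n) y :=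
      key_add _ _
    rw [e, e]
    exact add_le_add_left h _

instance : WellFoundedLT (GRevLexExp n) :=
  ⟨InvImage.wf (key (n := n)) (wellFounded_lt (α := Lex (Fin (n + 1) → ℕ)))⟩

end GRevLexExp

/-- The graded reverse lexicographic order on the monomials in `t_1, …, t_{n+1}`. -/
noncomputable def MonomialOrder.grevLex (n : ℕ) : MonomialOrder (Fin (n + 1)) where
  syn := GRevLexExp n
  toSyn :=
    { toFun := fun a => a
      invFun := fun a => a
      left_inv := fun _ => rfl
      right_inv := fun _ => rfl
      map_add' := fun _ _ => rfl }
  toSyn_monotone := by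
    intro a b h
    exact Pi.toLex_monotone fun k => Finset.sum_le_sum fun i _ => h i

/-- `t^a ≺ t^b` if and only if `deg t^a < deg t^b`, or the degrees agree and the last non-zero
entry of `b - a` is negative. -/
theorem MonomialOrder.grevLex_lt_iff {n : ℕ} {a b : Fin (n + 1) →₀ ℕ} :
    (MonomialOrder.grevLex n).toSyn a < (MonomialOrder.grevLex n).toSyn b ↔
      a.degree < b.degree ∨
        (a.degree = b.degree ∧ ∃ i, (∀ j, i < j → a j = b j) ∧ b i < a i) := by
  have step : (MonomialOrder.grevLex n).toSyn a < (MonomialOrder.grevLex n).toSyn b ↔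
      ∃ k, (∀ j, j < k → GRevLexExp.key a j = GRevLexExp.key b j) ∧
        GRevLexExp.key a k < GRevLexExp.key b k := Iff.rfl
  rw [step, ← GRevLexExp.key_zero_eq_degree, ← GRevLexExp.key_zero_eq_degree]
  constructor
  · rintro ⟨k, hk, hlt⟩
    rcases Fin.eq_zero_or_eq_succ k with rfl | ⟨l, rfl⟩
    · exact Or.inl hlt
    · refine Or.inr ⟨hk 0 (Fin.succ_pos l), Fin.rev l.castSucc, ?_, ?_⟩
      · intro j hj
        have hjn : (Fin.rev j).val < n := by
          have := l.isLt
          simp only [Fin.lt_def, Fin.val_rev, Fin.val_castSucc] at hj ⊢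
          omega
        have e : j = Fin.rev (Fin.castSucc ⟨(Fin.rev j).val, hjn⟩) := by
          ext
          have := j.isLt
          simp only [Fin.val_rev, Fin.val_castSucc]
          omega
        have ha := GRevLexExp.key_castSucc a ⟨(Fin.rev j).val, hjn⟩
        have hb := GRevLexExp.key_castSucc b ⟨(Fin.rev j).val, hjn⟩
        rw [← e] at ha hb
        have h1 := hk (Fin.castSucc ⟨(Fin.rev j).val, hjn⟩) (by
          simp only [Fin.lt_def, Fin.val_rev, Fin.val_castSucc, Fin.val_succ] at hj ⊢
          omega)
        have h2 := hk (Fin.succ ⟨(Fin.rev j).val, hjn⟩) (by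
          simp only [Fin.lt_def, Fin.val_rev, Fin.val_castSucc, Fin.val_succ] at hj ⊢
          omega)
        omega
      · have ha := GRevLexExp.key_castSucc a l
        have hb := GRevLexExp.key_castSucc b l
        have h1 := hk l.castSucc Fin.castSucc_lt_succ
        omega
  · rintro (h | ⟨h0, i, hi, hlt⟩)
    · exact ⟨0, fun j hj => absurd hj (Fin.not_lt_zero j), h⟩
    · have aux : ∀ k : Fin (n + 1), k ≤ Fin.rev i → GRevLexExp.key a k = GRevLexExp.key b k := by
        intro k
        induction k using Fin.induction with
        | zero => exact fun _ => h0
        | succ l ih =>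
          intro hl
          have hl' : l.castSucc ≤ Fin.rev i := le_trans (le_of_lt Fin.castSucc_lt_succ) hl
          have ha := GRevLexExp.key_castSucc a l
          have hb := GRevLexExp.key_castSucc b l
          have h1 := ih hl'
          have h2 := hi (Fin.rev l.castSucc) (by
            simp only [Fin.lt_def, Fin.le_def, Fin.val_rev, Fin.val_castSucc, Fin.val_succ] at hl ⊢
            omega)
          omega
      rcases Fin.eq_zero_or_eq_succ i with rfl | ⟨j, rfl⟩
      · have := aux (Fin.last n) (by simp)
        rw [GRevLexExp.key_last, GRevLexExp.key_last] at this
        omega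
      · have e : (j.succ : Fin (n + 1)) = Fin.rev (Fin.rev j).castSucc := by
          rw [Fin.rev_castSucc, Fin.rev_rev]
        have e' : Fin.rev j.succ = (Fin.rev j).castSucc := Fin.rev_succ j
        refine ⟨(Fin.rev j).succ, fun k hk => aux k ?_, ?_⟩
        · rw [e']
          simp only [Fin.lt_def, Fin.le_def, Fin.val_castSucc, Fin.val_succ] at hk ⊢
          omega
        · have ha := GRevLexExp.key_castSucc a (Fin.rev j)
          have hb := GRevLexExp.key_castSucc b (Fin.rev j)
          have h1 := aux (Fin.rev j).castSucc (le_of_eq e'.symm)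
          rw [← e] at ha hb
          omega

/-! ### Standard monomials -/

/-- The initial ideal `in_≺(I)`, generated by the initial monomials of the non-zero elements
of `I`. -/
noncomputable def initialIdeal {σ K : Type*} [Field K] (ord : MonomialOrder σ)
    (I : Ideal (MvPolynomial σ K)) : Ideal (MvPolynomial σ K) :=
  Ideal.span {u | ∃ f ∈ I, f ≠ 0 ∧ u = monomial (ord.degree f) 1}

/-- The footprint `Δ_≺(I)`: the (exponents of the) monomials that are not in `in_≺(I)`. -/
def footprint {σ K : Type*} [Field K] (ord : MonomialOrder σ)
    (I : Ideal (MvPolynomial σ K)) : Set (σ →₀ ℕ) :=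
  {a | monomial a (1 : K) ∉ initialIdeal ord I}

/-- `Δ_≺(I)_d`: the standard monomials of degree `d`. -/
def footprintDegree {σ K : Type*} [Field K] (ord : MonomialOrder σ)
    (I : Ideal (MvPolynomial σ K)) (d : ℕ) : Set (σ →₀ ℕ) :=
  {a | a ∈ footprint ord I ∧ a.degree = d}

/-- `KΔ_≺(I)`: the `K`-linear span of the standard monomials. -/
noncomputable def footprintSpan {σ K : Type*} [Field K] (ord : MonomialOrder σ)
    (I : Ideal (MvPolynomial σ K)) : Submodule K (MvPolynomial σ K) :=
  Submodule.span K ((fun a => monomial a (1 : K)) '' footprint ord I)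

/-! ### Minimal graded free resolutions, regularity, Gorenstein ideals -/

/-- A minimal graded free resolution `0 → F_g → ⋯ → F_1 → F_0 = S → S/I → 0` of the `S`-module
`S/I`, where `F_i = ⨁_k S(-shift i k)` has rank `rank i` and the map `F_{i+1} → F_i` is given by the
matrix `D i`. -/
structure MinimalGradedFreeResolution {σ K : Type*} [Field K] (I : Ideal (MvPolynomial σ K)) where
  /-- the rank of `F_i` -/
  rank : ℕ → ℕ
  /-- the degrees of the basis elements of `F_i` -/
  shift : (i : ℕ) → Fin (rank i) → ℕ
  /-- the matrix of `F_{i+1} → F_i` -/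
  D : (i : ℕ) → Matrix (Fin (rank i)) (Fin (rank (i + 1))) (MvPolynomial σ K)
  /-- the length `g` of the resolution, i.e. the projective dimension of `S/I` -/
  length : ℕ
  rank_length_ne_zero : rank length ≠ 0
  rank_eq_zero_of_length_lt : ∀ i, length < i → rank i = 0
  rank_zero : rank 0 = 1
  shift_zero : ∀ k, shift 0 k = 0
  /-- the maps are homogeneous of degree `0` -/
  homogeneous : ∀ i k l, D i k l ≠ 0 →
    ∃ e, e + shift i k = shift (i + 1) l ∧ (D i k l).IsHomogeneous e
  /-- minimality: `F_{i+1}` is mapped into `(t_1, …, t_s) F_i` -/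
  minimal : ∀ i k l, constantCoeff (D i k l) = 0
  /-- exactness at `F_{i+1}` -/
  exact_succ : ∀ i, Function.Exact (D (i + 1)).mulVecLin (D i).mulVecLin
  /-- exactness at `F_0 = S`: the image of `F_1 → S` is `I` -/
  exact_zero : ∀ f, f ∈ I ↔ (fun _ => f) ∈ LinearMap.range (D 0).mulVecLin

/-- The graded Betti number `b_{i,j}`: the number of summands `S(-j)` of `F_i`. -/
def MinimalGradedFreeResolution.betti {σ K : Type*} [Field K] {I : Ideal (MvPolynomial σ K)}
    (F : MinimalGradedFreeResolution I) (i j : ℕ) : ℕ :=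
  (Finset.univ.filter fun k => F.shift i k = j).card

/-- The Castelnuovo–Mumford regularity `reg(S/I) = max {j - i | b_{i,j} ≠ 0}`. The minimal graded
free resolution is unique up to isomorphism, so that it does not matter which one is used. -/
noncomputable def quotientRegularity {σ K : Type*} [Field K] (I : Ideal (MvPolynomial σ K)) : ℕ :=
  sSup {r | ∃ (F : MinimalGradedFreeResolution I) (i j : ℕ), F.betti i j ≠ 0 ∧ j = r + i}

/-- `I` is Gorenstein: in the last step `g` of the minimal graded free resolution of `S/I` there is
a unique `j` with `b_{g,j} ≠ 0`, and `b_{g,j} = 1`. -/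
def IsGorensteinIdeal {σ K : Type*} [Field K] (I : Ideal (MvPolynomial σ K)) : Prop :=
  ∃ (F : MinimalGradedFreeResolution I) (j : ℕ),
    F.betti F.length j = 1 ∧ ∀ j', F.betti F.length j' ≠ 0 → j' = j

/-! ### Projective points, indicator functions, codes -/

/-- The graded vanishing ideal of the projective points with representatives `P i`: the ideal
generated by the homogeneous polynomials that vanish at all of them. -/
noncomputable def gradedVanishingIdeal {σ K ι : Type*} [Field K] (P : ι → σ → K) : Ideal (MvPolynomial σ K) :=
  Ideal.span {f | (∃ d, f.IsHomogeneous d) ∧ ∀ i, eval (P i) f = 0}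

/-- The vanishing ideal `𝔭` of a single projective point with representative `p`. -/
noncomputable def pointIdeal {σ K : Type*} [Field K] (p : σ → K) : Ideal (MvPolynomial σ K) :=
  gradedVanishingIdeal fun _ : Unit => p

/-- The v-number of `I` at `𝔭`: `v_𝔭(I) = min {d | ∃ f ∈ S_d, (I : f) = 𝔭}`. -/
noncomputable def vNumber {σ K : Type*} [Field K] (I 𝔭 : Ideal (MvPolynomial σ K)) : ℕ :=
  sInf {d | ∃ f : MvPolynomial σ K, f.IsHomogeneous d ∧ I.colon {f} = 𝔭}

/-- `f` is an indicator function of `[P i]`. -/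
def IsIndicatorFunction {σ K ι : Type*} [Field K] (P : ι → σ → K) (i : ι)
    (f : MvPolynomial σ K) : Prop :=
  (∃ d, f.IsHomogeneous d) ∧ eval (P i) f ≠ 0 ∧ ∀ j, j ≠ i → eval (P j) f = 0

/-- `f` is the `i`-th standard indicator function: the indicator function of `[P i]` in `KΔ_≺(I)` of
degree `v_{𝔭_i}(I)`, which is unique up to multiplication by a non-zero scalar. -/
def IsStandardIndicatorFunction {σ K ι : Type*} [Field K] (ord : MonomialOrder σ) (P : ι → σ → K)
    (i : ι) (f : MvPolynomial σ K) : Prop :=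
  IsIndicatorFunction P i f ∧ f ∈ footprintSpan ord (gradedVanishingIdeal P) ∧
    f.IsHomogeneous (vNumber (gradedVanishingIdeal P) (pointIdeal (P i)))

/-- `t^a` is essential: it is a standard monomial that appears in each standard indicator function
`f_i`. -/
def IsEssentialMonomial {σ K ι : Type*} [Field K] (ord : MonomialOrder σ) (P : ι → σ → K)
    (a : σ →₀ ℕ) : Prop :=
  a ∈ footprint ord (gradedVanishingIdeal P) ∧
    ∀ i f, IsStandardIndicatorFunction ord P i f → coeff a f ≠ 0

/-- The evaluation map `f ↦ (f(P_i))_i`. -/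
noncomputable def evaluationMap {σ K ι : Type*} [Field K] (P : ι → σ → K) :
    MvPolynomial σ K →ₗ[K] (ι → K) :=
  LinearMap.pi fun i => (aeval (P i)).toLinearMap

/-- The projective Reed–Muller-type code `C_𝕏(d)`: the image of `S_d` under evaluation. -/
noncomputable def reedMullerCode {σ K ι : Type*} [Field K] (P : ι → σ → K) (d : ℕ) :
    Submodule K (ι → K) :=
  (homogeneousSubmodule σ K d).map (evaluationMap P)

/-- `H` is a parity check matrix of the linear code `C`: its rows are linearly independent and
`C = {x | H x = 0}`. -/
def IsParityCheckMatrix {K ι κ : Type*} [Field K] [Fintype ι] (H : Matrix κ ι K)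
    (C : Submodule K (ι → K)) : Prop :=
  LinearIndependent K H.row ∧ ∀ x, x ∈ C ↔ H.mulVec x = 0

/-!
Write `J = (I, t_s)`. Let `F` be the minimal graded free resolution of `S/I`, and let `J_k` be the
ideal generated by the last `k` variables. Since `t_s` is regular on `S/I` and each variable is
regular modulo the ones after it, the complex `F/J_k F` is exact at `F_i` whenever `i ≥ k ≥ 1`. The
connecting maps of the sequences `0 → F/J_k F → F/J_k F → F/J_{k+1} F → 0`, given by multiplication
by the next variable, then embed the socle of `S/J` into `F_n/𝔪F_n` (where `s = n + 1`) and raise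
degrees by `n`. Hence `F` has length at most `n`, and if `I` is Gorenstein, then the socle of `S/J`
is at most one-dimensional. Moreover, `reg(S/I)` is the largest degree in which `S/J` is non-zero.

An indicator function of minimal degree represents a non-zero element of the socle of `S/J`, and
forms of larger degree than all the `f_i` are in `J` by interpolation. Thus all `f_i` have degree
`r₀`. For GRevLex, the standard monomials that are not divisible by `t_s` are linearly independent
modulo `J`, so there is only one of degree `r₀`, and it leads every `f_i`. For the parity check,
`x` is in `C_𝕏(r₀ - 1)` if and only if the combination of the `f_i` with values `x` is in `J`.
-/

section ModuloIdeal

variable {R : Type*} [CommRing R] {M : ℕ → Type*} [∀ i, AddCommGroup (M i)] [∀ i, Module R (M i)]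

/-- The cycles of the complex `(M, δ)` modulo the ideal `J`, as a submodule of `M i`. -/
def cyclesMod (δ : ∀ i, M (i + 1) →ₗ[R] M i) (J : Ideal R) : ∀ i, Submodule R (M i)
  | 0 => ⊤
  | i + 1 => (J • ⊤ : Submodule R (M i)).comap (δ i)

/-- The boundaries of the complex `(M, δ)` modulo the ideal `J`, as a submodule of `M i`. -/
def boundariesMod (δ : ∀ i, M (i + 1) →ₗ[R] M i) (J : Ideal R) (i : ℕ) : Submodule R (M i) :=
  LinearMap.range (δ i) ⊔ J • ⊤

theorem mem_smul_top_sup_span_singleton_iff {N : Type*} [AddCommGroup N] [Module R N]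
    {J : Ideal R} {r : R} {v : N} :
    v ∈ ((J ⊔ Ideal.span {r}) • ⊤ : Submodule R N) ↔
      ∃ w, v - r • w ∈ (J • ⊤ : Submodule R N) := by
  rw [Submodule.sup_smul, Submodule.ideal_span_singleton_smul, sup_comm, Submodule.mem_sup]
  constructor
  · rintro ⟨_, ⟨w, -, rfl⟩, b, hb, rfl⟩
    exact ⟨w, by simpa using hb⟩
  · rintro ⟨w, hw⟩
    exact ⟨r • w, ⟨w, trivial, rfl⟩, _, hw, add_sub_cancel _ _⟩

variable {δ : ∀ i, M (i + 1) →ₗ[R] M i} {J : Ideal R} {r : R} {i : ℕ}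

theorem mem_boundariesMod_iff {v : M i} :
    v ∈ boundariesMod δ J i ↔ ∃ y, v - δ i y ∈ (J • ⊤ : Submodule R (M i)) := by
  rw [boundariesMod, Submodule.mem_sup]
  constructor
  · rintro ⟨_, ⟨y, rfl⟩, b, hb, rfl⟩
    exact ⟨y, by simpa using hb⟩
  · rintro ⟨y, hy⟩
    exact ⟨δ i y, ⟨y, rfl⟩, _, hy, add_sub_cancel _ _⟩

theorem boundariesMod_mono {J' : Ideal R} (h : J ≤ J') :
    boundariesMod δ J i ≤ boundariesMod δ J' i :=
  sup_le_sup_left (Submodule.smul_mono_left h) _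

theorem mem_boundariesMod_sup_span_singleton_iff {v : M i} :
    v ∈ boundariesMod δ (J ⊔ Ideal.span {r}) i ↔ ∃ y, v - r • y ∈ boundariesMod δ J i := by
  simp only [mem_boundariesMod_iff, mem_smul_top_sup_span_singleton_iff, sub_right_comm v]
  exact exists_comm

theorem exists_connecting (hδ : ∀ i v, δ i (δ (i + 1) v) = 0)
    (hr : ∀ i, IsSMulRegular (M i ⧸ (J • ⊤ : Submodule R (M i))) r) {v : M (i + 1)}
    (hv : v ∈ cyclesMod δ (J ⊔ Ideal.span {r}) (i + 1)) :
    ∃ w ∈ cyclesMod δ J i, δ i v - r • w ∈ (J • ⊤ : Submodule R (M i)) := by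
  obtain ⟨w, hw⟩ := mem_smul_top_sup_span_singleton_iff.1 hv
  refine ⟨w, ?_, hw⟩
  cases i with
  | zero => trivial
  | succ i =>
    refine (isSMulRegular_quotient_iff_mem_of_smul_mem _ _).1 (hr i) _ ?_
    have h := Submodule.smul_top_le_comap_smul_top J (δ i) hw
    rwa [Submodule.mem_comap, map_sub, hδ, zero_sub, map_smul, neg_mem_iff] at h

theorem sub_smul_mem_cyclesMod {v y : M (i + 1)} {w : M i}
    (hvw : δ i v - r • w ∈ (J • ⊤ : Submodule R (M i)))
    (hwy : w - δ i y ∈ (J • ⊤ : Submodule R (M i))) : v - r • y ∈ cyclesMod δ J (i + 1) := by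
  have h := add_mem hvw (Submodule.smul_mem _ r hwy)
  rwa [smul_sub, sub_add_sub_cancel, ← map_smul, ← map_sub] at h

theorem cyclesMod_sup_span_singleton_le (hδ : ∀ i v, δ i (δ (i + 1) v) = 0)
    (hr : ∀ i, IsSMulRegular (M i ⧸ (J • ⊤ : Submodule R (M i))) r)
    (h₁ : cyclesMod δ J (i + 1) ≤ boundariesMod δ J (i + 1))
    (h₀ : ∀ w ∈ cyclesMod δ J i, r • w ∈ boundariesMod δ J i → w ∈ boundariesMod δ J i) :
    cyclesMod δ (J ⊔ Ideal.span {r}) (i + 1) ≤ boundariesMod δ (J ⊔ Ideal.span {r}) (i + 1) := by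
  intro v hv
  obtain ⟨w, hw, hvw⟩ := exists_connecting hδ hr hv
  have hrw : r • w ∈ boundariesMod δ J i :=
    mem_boundariesMod_iff.2 ⟨v, by rwa [← neg_mem_iff, neg_sub]⟩
  obtain ⟨y, hy⟩ := mem_boundariesMod_iff.1 (h₀ w hw hrw)
  exact mem_boundariesMod_sup_span_singleton_iff.2 ⟨y, h₁ (sub_smul_mem_cyclesMod hvw hy)⟩

theorem smul_mem_boundariesMod_of_connecting
    (h₁ : cyclesMod δ J (i + 1) ≤ boundariesMod δ J (i + 1)) {t : R} {v : M i} {w : M (i + 1)}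
    (hvw : r • v - δ i w ∈ (J • ⊤ : Submodule R (M i))) (hv : t • v ∈ boundariesMod δ J i) :
    t • w ∈ boundariesMod δ (J ⊔ Ideal.span {r}) (i + 1) := by
  obtain ⟨y, hy⟩ := mem_boundariesMod_iff.1 hv
  have hw : δ i (t • w) - r • t • v ∈ (J • ⊤ : Submodule R (M i)) := by
    have h := Submodule.smul_mem _ (-t) hvw
    rwa [neg_smul, smul_sub, neg_sub, smul_comm t r, ← map_smul] at h
  exact mem_boundariesMod_sup_span_singleton_iff.2 ⟨y, h₁ (sub_smul_mem_cyclesMod hw hy)⟩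

theorem mem_boundariesMod_of_connecting (hδ : ∀ i v, δ i (δ (i + 1) v) = 0)
    (hr : IsSMulRegular (M i ⧸ (J • ⊤ : Submodule R (M i))) r) {v : M i} {w : M (i + 1)}
    (hvw : r • v - δ i w ∈ (J • ⊤ : Submodule R (M i)))
    (hw : w ∈ boundariesMod δ (J ⊔ Ideal.span {r}) (i + 1)) : v ∈ boundariesMod δ J i := by
  obtain ⟨y, hy⟩ := mem_boundariesMod_sup_span_singleton_iff.1 hw
  obtain ⟨z, hz⟩ := mem_boundariesMod_iff.1 hy
  refine mem_boundariesMod_iff.2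
    ⟨y, (isSMulRegular_quotient_iff_mem_of_smul_mem _ _).1 hr _ ?_⟩
  have h := add_mem hvw (Submodule.smul_top_le_comap_smul_top J (δ i) hz)
  rwa [map_sub, map_sub, hδ, sub_zero, map_smul, sub_add_sub_cancel, ← smul_sub] at h

end ModuloIdeal

/-- The ideal generated by the first `k` terms of the sequence `x`. -/
def prefixIdeal {R : Type*} [CommRing R] (x : ℕ → R) (k : ℕ) : Ideal R :=
  Ideal.span (x '' Set.Iio k)

section PrefixIdeal

variable {R : Type*} [CommRing R]

@[simp]
theorem prefixIdeal_zero (x : ℕ → R) : prefixIdeal x 0 = ⊥ := by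
  simp [prefixIdeal]

theorem prefixIdeal_succ (x : ℕ → R) (k : ℕ) :
    prefixIdeal x (k + 1) = prefixIdeal x k ⊔ Ideal.span {x k} := by
  rw [prefixIdeal, Set.Iio_add_one_eq_Iic, ← Set.Iio_insert, Set.image_insert_eq,
    Ideal.span_insert, sup_comm, prefixIdeal]

variable {M : ℕ → Type*} [∀ i, AddCommGroup (M i)] [∀ i, Module R (M i)]
  {δ : ∀ i, M (i + 1) →ₗ[R] M i} {x : ℕ → R} {n : ℕ}

/-- Dividing out one more element of a regular sequence costs at most one homological degree. -/
theorem cyclesMod_prefixIdeal_le (hδ : ∀ i, Function.Exact (δ (i + 1)) (δ i))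
    (hx : ∀ k ≤ n, ∀ i, IsSMulRegular (M i ⧸ (prefixIdeal x k • ⊤ : Submodule R (M i))) (x k))
    (hx₀ : IsSMulRegular (M 0 ⧸ LinearMap.range (δ 0)) (x 0)) {k i : ℕ} (hk : k ≤ n)
    (hi : k ≤ i) :
    cyclesMod δ (prefixIdeal x (k + 1)) (i + 1) ≤
      boundariesMod δ (prefixIdeal x (k + 1)) (i + 1) := by
  have hδδ : ∀ i v, δ i (δ (i + 1) v) = 0 := fun i => (hδ i).apply_apply_eq_zero
  have hbot : ∀ i, cyclesMod δ ⊥ (i + 1) ≤ boundariesMod δ ⊥ (i + 1) := fun i v hv => by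
    obtain ⟨y, hy⟩ := (hδ i v).1 (by simpa [cyclesMod] using hv)
    exact mem_boundariesMod_iff.2 ⟨y, by simp [hy]⟩
  induction k generalizing i with
  | zero =>
    have hx₀' := hx 0 hk
    rw [prefixIdeal_succ, prefixIdeal_zero] at *
    refine cyclesMod_sup_span_singleton_le hδδ hx₀' (hbot i) fun w hw hrw => ?_
    cases i with
    | zero =>
      rw [boundariesMod, Submodule.bot_smul, sup_bot_eq] at hrw ⊢
      exact (isSMulRegular_quotient_iff_mem_of_smul_mem _ _).1 hx₀ w hrw
    | succ i => exact hbot i hw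
  | succ k ih =>
    obtain ⟨i, rfl⟩ := Nat.exists_eq_succ_of_ne_zero (by omega : i ≠ 0)
    rw [prefixIdeal_succ x (k + 1)]
    exact cyclesMod_sup_span_singleton_le hδδ (hx _ hk) (ih (by omega) (by omega))
      fun w hw _ => ih (by omega) (by omega) hw

/-- The sequences `u₀, …, uₙ` in which `u (k + 1)` is a lift of `u k` along the connecting map
`H_{k+1}(M / (x₀, …, x_{k+1}) M) → H_k(M / (x₀, …, x_k) M)`. -/
def connectingChains (δ : ∀ i, M (i + 1) →ₗ[R] M i) (x : ℕ → R) (n : ℕ) :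
    Submodule R (∀ k, M k) :=
  ⨅ k < n, (prefixIdeal x (k + 1) • ⊤ : Submodule R (M k)).comap
    (x (k + 1) • LinearMap.proj k - δ k ∘ₗ LinearMap.proj (k + 1))

theorem mem_connectingChains_iff {u : ∀ k, M k} :
    u ∈ connectingChains δ x n ↔
      ∀ k < n, x (k + 1) • u k - δ k (u (k + 1)) ∈
        (prefixIdeal x (k + 1) • ⊤ : Submodule R (M k)) := by
  simp [connectingChains, Submodule.mem_iInf]

theorem exists_mem_connectingChains
    (hac : ∀ k < n, cyclesMod δ (prefixIdeal x (k + 1)) (k + 1) ≤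
      boundariesMod δ (prefixIdeal x (k + 1)) (k + 1))
    {v : M 0} (hv : ∀ j, x j • v ∈ boundariesMod δ (prefixIdeal x 1) 0) :
    ∃ u ∈ connectingChains δ x n, u 0 = v ∧
      ∀ j, x j • u n ∈ boundariesMod δ (prefixIdeal x (n + 1)) n := by
  induction n with
  | zero =>
    exact ⟨Pi.single 0 v, mem_connectingChains_iff.2 (by simp), by simp, by simpa using hv⟩
  | succ n ih =>
    obtain ⟨u, hu, rfl, hun⟩ := ih fun k hk => hac k (hk.trans n.lt_succ_self)
    obtain ⟨w, hw⟩ := mem_boundariesMod_iff.1 (hun (n + 1))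
    refine ⟨Function.update u (n + 1) w, mem_connectingChains_iff.2 fun k hk => ?_, by simp,
      fun j => ?_⟩
    · rcases (Nat.lt_succ_iff_lt_or_eq.1 hk) with hkn | rfl
      · rw [Function.update_of_ne (by omega), Function.update_of_ne (by omega)]
        exact mem_connectingChains_iff.1 hu k hkn
      · simpa using hw
    · rw [Function.update_self, prefixIdeal_succ x (n + 1)]
      exact smul_mem_boundariesMod_of_connecting (hac n n.lt_succ_self) hw (hun j)

theorem apply_zero_mem_boundariesMod_of_mem_connectingChains
    (hδ : ∀ i v, δ i (δ (i + 1) v) = 0)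
    (hx : ∀ k ≤ n, ∀ i, IsSMulRegular (M i ⧸ (prefixIdeal x k • ⊤ : Submodule R (M i))) (x k))
    {u : ∀ k, M k} (hu : u ∈ connectingChains δ x n)
    (hun : u n ∈ boundariesMod δ (prefixIdeal x (n + 1)) n) :
    u 0 ∈ boundariesMod δ (prefixIdeal x 1) 0 := by
  rw [mem_connectingChains_iff] at hu
  induction n with
  | zero => exact hun
  | succ n ih =>
    refine ih (fun k hk => hx k (by omega)) (fun k hk => hu k (by omega)) ?_
    rw [prefixIdeal_succ x (n + 1)] at hun
    exact mem_boundariesMod_of_connecting hδ (hx (n + 1) le_rfl n) (hu n n.lt_succ_self) hun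

end PrefixIdeal

section Pi

variable {R ι : Type*} [CommRing R] [Finite ι] {J : Ideal R}

theorem mem_smul_top_pi_iff {v : ι → R} :
    v ∈ (J • ⊤ : Submodule R (ι → R)) ↔ ∀ i, v i ∈ J := by
  have := Fintype.ofFinite ι
  classical
  constructor
  · intro hv i
    simpa using Submodule.smul_top_le_comap_smul_top J (LinearMap.proj (R := R) i) hv
  · intro hv
    rw [pi_eq_sum_univ' v]
    exact Submodule.sum_mem _ fun i _ => Submodule.smul_mem_smul (hv i) trivial

theorem isSMulRegular_pi_quotient_smul_top {r : R} (hr : IsSMulRegular (R ⧸ J) r) :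
    IsSMulRegular ((ι → R) ⧸ (J • ⊤ : Submodule R (ι → R))) r := by
  rw [isSMulRegular_quotient_iff_mem_of_smul_mem] at hr ⊢
  simp only [mem_smul_top_pi_iff]
  exact fun v hv i => hr _ (hv i)

end Pi

section Polynomials

attribute [local instance] MvPolynomial.gradedAlgebra

variable {σ R : Type*} [CommRing R]

theorem decompose_homogeneousSubmodule_apply (p : MvPolynomial σ R) (d : ℕ) :
    (DirectSum.decompose (homogeneousSubmodule σ R) p d : MvPolynomial σ R) =
      homogeneousComponent d p :=
  decomposition.decompose'_apply p d

theorem homogeneousComponent_mul_left_of_le {p : MvPolynomial σ R} {e d : ℕ}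
    (hp : p.IsHomogeneous e) (h : e ≤ d) (q : MvPolynomial σ R) :
    homogeneousComponent d (p * q) = p * homogeneousComponent (d - e) q := by
  simp only [← decompose_homogeneousSubmodule_apply]
  exact DirectSum.coe_decompose_mul_of_left_mem_of_le (homogeneousSubmodule σ R) hp h

theorem homogeneousComponent_mul_left_of_lt {p : MvPolynomial σ R} {e d : ℕ}
    (hp : p.IsHomogeneous e) (h : d < e) (q : MvPolynomial σ R) :
    homogeneousComponent d (p * q) = 0 := by
  rw [← decompose_homogeneousSubmodule_apply]
  exact DirectSum.coe_decompose_mul_of_left_mem_of_not_le (homogeneousSubmodule σ R) hp h.not_ge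

theorem homogeneousComponent_succ_X_mul (j : σ) (d : ℕ) (p : MvPolynomial σ R) :
    homogeneousComponent (d + 1) (X j * p) = X j * homogeneousComponent d p :=
  homogeneousComponent_mul_left_of_le (isHomogeneous_X R j) (Nat.le_add_left 1 d) p

theorem homogeneousComponent_zero_X_mul (j : σ) (p : MvPolynomial σ R) :
    homogeneousComponent 0 (X j * p) = 0 :=
  homogeneousComponent_mul_left_of_lt (isHomogeneous_X R j) Nat.one_pos p

theorem isHomogeneous_span_X_image (s : Set σ) :
    (Ideal.span (X '' s : Set (MvPolynomial σ R))).IsHomogeneous (homogeneousSubmodule σ R) := by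
  refine Ideal.homogeneous_span _ _ ?_
  rintro _ ⟨j, -, rfl⟩
  exact ⟨1, isHomogeneous_X R j⟩

theorem mem_span_singleton_X_iff {p : MvPolynomial σ R} {j : σ} :
    p ∈ Ideal.span {X j} ↔ ∀ a ∈ p.support, a j ≠ 0 := by
  simpa using mem_ideal_span_X_image (x := p) (s := {j})

theorem isSMulRegular_quotient_span_X_image {s : Set σ} {j : σ} (hj : j ∉ s) :
    IsSMulRegular (MvPolynomial σ R ⧸ Ideal.span (X '' s : Set (MvPolynomial σ R)))
      (X j : MvPolynomial σ R) := by
  rw [isSMulRegular_quotient_iff_mem_of_smul_mem]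
  intro p hp
  rw [smul_eq_mul, mem_ideal_span_X_image] at hp
  rw [mem_ideal_span_X_image]
  intro a ha
  obtain ⟨i, hi, hai⟩ := hp (Finsupp.single j 1 + a) (by
    rwa [mem_support_iff, coeff_X_mul, ← mem_support_iff])
  have hne : j ≠ i := fun h => hj (h ▸ hi)
  exact ⟨i, hi, by simpa [Finsupp.single_apply, hne] using hai⟩

theorem mem_idealOfVars_iff {p : MvPolynomial σ R} :
    p ∈ idealOfVars σ R ↔ constantCoeff p = 0 := by
  rw [← pow_one (idealOfVars σ R), mem_pow_idealOfVars_iff']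
  simp [Finsupp.degree_eq_zero_iff, constantCoeff_eq]

/-- The variables `t_s, t_{s-1}, …, t_1`, as the start of a sequence (the later terms, a periodic
continuation, play no role). -/
noncomputable def reversedVars (R : Type*) [CommRing R] (n k : ℕ) :
    MvPolynomial (Fin (n + 1)) R :=
  X (Fin.rev (Fin.ofNat (n + 1) k))

variable (R) in
theorem prefixIdeal_reversedVars (n k : ℕ) :
    prefixIdeal (reversedVars R n) k =
      Ideal.span (X '' ((fun j => Fin.rev (Fin.ofNat (n + 1) j)) '' Set.Iio k)) := by
  rw [Set.image_image]
  rfl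

variable (R) in
theorem prefixIdeal_reversedVars_one (n : ℕ) :
    prefixIdeal (reversedVars R n) 1 = Ideal.span {X (Fin.last n)} :=
  (prefixIdeal_succ _ 0).trans (by rw [prefixIdeal_zero, bot_sup_eq]; rfl)

variable (R) in
theorem prefixIdeal_reversedVars_eq_idealOfVars (n : ℕ) :
    prefixIdeal (reversedVars R n) (n + 1) = idealOfVars (Fin (n + 1)) R := by
  have h : (fun j => Fin.rev (Fin.ofNat (n + 1) j)) '' Set.Iio (n + 1) = Set.univ := by
    refine Set.eq_univ_of_forall fun i => ⟨i.rev, i.rev.isLt, ?_⟩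
    simp only [Fin.ofNat_val_eq_self, Fin.rev_rev]
  rw [prefixIdeal_reversedVars, h, Set.image_univ]

variable (R) in
theorem isSMulRegular_reversedVars {n k : ℕ} (hk : k ≤ n) :
    IsSMulRegular (MvPolynomial (Fin (n + 1)) R ⧸ prefixIdeal (reversedVars R n) k)
      (reversedVars R n k) := by
  rw [prefixIdeal_reversedVars]
  refine isSMulRegular_quotient_span_X_image ?_
  rintro ⟨j, hj, hjk⟩
  rw [Set.mem_Iio] at hj
  have := congrArg Fin.val (Fin.rev_injective hjk)
  simp only [Fin.ofNat, Nat.mod_eq_of_lt (show j < n + 1 by omega),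
    Nat.mod_eq_of_lt (show k < n + 1 by omega)] at this
  omega

variable (R) in
theorem isHomogeneous_prefixIdeal_reversedVars (n k : ℕ) :
    (prefixIdeal (reversedVars R n) k).IsHomogeneous (homogeneousSubmodule (Fin (n + 1)) R) := by
  rw [prefixIdeal_reversedVars]
  exact isHomogeneous_span_X_image _

/-- The ideal `(I, t_j)` cutting out the section of `Proj(S/I)` with the hyperplane `t_j = 0`. If
`S/I` is one-dimensional and `t_j` is regular on it, this gives its Artinian reduction. -/
noncomputable def hyperplaneSection (I : Ideal (MvPolynomial σ R)) (j : σ) :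
    Ideal (MvPolynomial σ R) :=
  I ⊔ Ideal.span {X j}

variable {I : Ideal (MvPolynomial σ R)} {j : σ}

theorem mem_hyperplaneSection_iff {p : MvPolynomial σ R} :
    p ∈ hyperplaneSection I j ↔ ∃ q, p - X j * q ∈ I := by
  rw [hyperplaneSection, Submodule.mem_sup]
  constructor
  · rintro ⟨g, hg, _, hb, rfl⟩
    obtain ⟨q, rfl⟩ := Ideal.mem_span_singleton.1 hb
    exact ⟨q, by simpa using hg⟩
  · rintro ⟨q, hq⟩
    exact ⟨_, hq, _, Ideal.mul_mem_right _ _ (Ideal.mem_span_singleton_self _), sub_add_cancel _ _⟩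

theorem isHomogeneous_hyperplaneSection (hI : I.IsHomogeneous (homogeneousSubmodule σ R)) (j : σ) :
    (hyperplaneSection I j).IsHomogeneous (homogeneousSubmodule σ R) := by
  have h := isHomogeneous_span_X_image (R := R) {j}
  rw [Set.image_singleton] at h
  exact hI.sup h

theorem exists_homogeneous_of_mem_hyperplaneSection
    (hI : I.IsHomogeneous (homogeneousSubmodule σ R)) {p : MvPolynomial σ R} {d : ℕ}
    (hp : p.IsHomogeneous d) (h : p ∈ hyperplaneSection I j) :
    ∃ q, (q = 0 ∨ ∃ e, d = e + 1 ∧ q.IsHomogeneous e) ∧ p - X j * q ∈ I := by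
  obtain ⟨q, hq⟩ := mem_hyperplaneSection_iff.1 h
  have hd := homogeneousComponent_mem_of_mem hI hq d
  rw [map_sub, homogeneousComponent_eq_self hp] at hd
  cases d with
  | zero => exact ⟨0, Or.inl rfl, by rwa [mul_zero, ← homogeneousComponent_zero_X_mul j q]⟩
  | succ e =>
    rw [homogeneousComponent_succ_X_mul] at hd
    exact ⟨_, Or.inr ⟨e, rfl, homogeneousComponent_isHomogeneous e q⟩, hd⟩

theorem exists_mem_support_of_notMem_hyperplaneSection {p : MvPolynomial σ R}
    (hp : p ∉ hyperplaneSection I j) : ∃ a ∈ p.support, a j = 0 := by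
  by_contra! h
  exact hp (Ideal.mem_sup_right (mem_span_singleton_X_iff.2 h))

end Polynomials

/-- The elements of `S` that represent the socle of `S/J`. -/
noncomputable def socleLift {σ K : Type*} [Field K] (J : Ideal (MvPolynomial σ K)) :
    Ideal (MvPolynomial σ K) :=
  J.colon (Set.range X)

/-- The socle of `S/J` is zero or one-dimensional, stated in terms of representatives. -/
def SocleAtMostOneDimensional {σ K : Type*} [Field K] (J : Ideal (MvPolynomial σ K)) : Prop :=
  ∀ p ∈ socleLift J, ∀ q ∈ socleLift J, q ∉ J → ∃ c : K, p - C c * q ∈ J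

theorem mem_socleLift_iff {σ K : Type*} [Field K] {J : Ideal (MvPolynomial σ K)}
    {p : MvPolynomial σ K} : p ∈ socleLift J ↔ ∀ j, X j * p ∈ J := by
  simp [socleLift, Submodule.mem_colon, mul_comm]

attribute [local instance] MvPolynomial.gradedAlgebra in
theorem SocleAtMostOneDimensional.degree_eq {σ K : Type*} [Field K]
    {J : Ideal (MvPolynomial σ K)} (h : SocleAtMostOneDimensional J)
    (hJ : J.IsHomogeneous (homogeneousSubmodule σ K)) {p q : MvPolynomial σ K} {d e : ℕ}
    (hp : p ∈ socleLift J) (hpd : p.IsHomogeneous d) (hpJ : p ∉ J)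
    (hq : q ∈ socleLift J) (hqe : q.IsHomogeneous e) (hqJ : q ∉ J) : d = e := by
  by_contra hde
  obtain ⟨c, hc⟩ := h p hp q hq hqJ
  have hcomp := homogeneousComponent_mem_of_mem hJ hc d
  rw [map_sub, homogeneousComponent_eq_self hpd, homogeneousComponent_of_mem (hqe.C_mul c),
    if_neg hde, sub_zero] at hcomp
  exact hpJ hcomp

namespace MinimalGradedFreeResolution

attribute [local instance] MvPolynomial.gradedAlgebra

section

variable {K σ : Type*} [Field K] {I : Ideal (MvPolynomial σ K)}
  (F : MinimalGradedFreeResolution I)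

/-- The `i`-th module `F_i` of the resolution. -/
abbrev Term (i : ℕ) : Type _ := Fin (F.rank i) → MvPolynomial σ K

/-- The map `F_{i+1} → F_i` of the resolution. -/
noncomputable abbrev differential (i : ℕ) : F.Term (i + 1) →ₗ[MvPolynomial σ K] F.Term i :=
  (F.D i).mulVecLin

theorem differential_differential (i : ℕ) (v : F.Term (i + 2)) :
    F.differential i (F.differential (i + 1) v) = 0 :=
  (F.exact_succ i).apply_apply_eq_zero v

/-- The projection of `F_i` onto its homogeneous part of degree `d`, where the `k`-th basis element
has degree `shift i k`. -/
noncomputable def degreePart (d i : ℕ) : F.Term i →ₗ[K] F.Term i :=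
  LinearMap.pi fun k =>
    if F.shift i k ≤ d then homogeneousComponent (d - F.shift i k) ∘ₗ LinearMap.proj k else 0

variable {F}

theorem degreePart_apply (d i : ℕ) (v : F.Term i) (k : Fin (F.rank i)) :
    F.degreePart d i v k =
      if F.shift i k ≤ d then homogeneousComponent (d - F.shift i k) (v k) else 0 := by
  rw [degreePart, LinearMap.pi_apply]
  split_ifs <;> rfl

theorem degreePart_zero_apply (d : ℕ) (v : F.Term 0) (k : Fin (F.rank 0)) :
    F.degreePart d 0 v k = homogeneousComponent d (v k) := by
  simp [degreePart_apply, F.shift_zero]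

theorem degreePart_degreePart (d i : ℕ) (v : F.Term i) :
    F.degreePart d i (F.degreePart d i v) = F.degreePart d i v := by
  ext1 k
  simp only [degreePart_apply]
  split_ifs
  · exact homogeneousComponent_eq_self (homogeneousComponent_isHomogeneous _ _)
  · rfl

theorem degreePart_D_mul (d i : ℕ) (v : F.Term (i + 1)) (k : Fin (F.rank i))
    (l : Fin (F.rank (i + 1))) :
    (if F.shift i k ≤ d then homogeneousComponent (d - F.shift i k) (F.D i k l * v l) else 0) =
      F.D i k l * F.degreePart d (i + 1) v l := by
  by_cases h0 : F.D i k l = 0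
  · simp [h0]
  obtain ⟨e, he, hhom⟩ := F.homogeneous i k l h0
  rw [degreePart_apply]
  split_ifs
  · rw [homogeneousComponent_mul_left_of_le hhom (by omega), ← he, Nat.sub_add_eq,
      Nat.sub_right_comm]
  · rw [homogeneousComponent_mul_left_of_lt hhom (by omega), mul_zero]
  · omega
  · rw [mul_zero]

theorem degreePart_differential (d i : ℕ) (v : F.Term (i + 1)) :
    F.degreePart d i (F.differential i v) = F.differential i (F.degreePart d (i + 1) v) := by
  ext1 k
  rw [degreePart_apply]
  simp only [Matrix.mulVecLin_apply, Matrix.mulVec, dotProduct, ← degreePart_D_mul, map_sum]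
  split_ifs <;> simp

theorem degreePart_succ_X_smul (d i : ℕ) (j : σ) (v : F.Term i) :
    F.degreePart (d + 1) i ((X j : MvPolynomial σ K) • v) =
      (X j : MvPolynomial σ K) • F.degreePart d i v := by
  ext1 k
  simp only [degreePart_apply, Pi.smul_apply, smul_eq_mul]
  split_ifs with h₁ h₂ h₂
  · rw [Nat.sub_add_comm h₂, homogeneousComponent_succ_X_mul]
  · rw [Nat.sub_eq_zero_of_le (by omega), homogeneousComponent_zero_X_mul, mul_zero]
  · omega
  · rw [mul_zero]

theorem degreePart_mem_smul_top {J : Ideal (MvPolynomial σ K)}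
    (hJ : J.IsHomogeneous (homogeneousSubmodule σ K)) {d i : ℕ} {v : F.Term i}
    (hv : v ∈ (J • ⊤ : Submodule (MvPolynomial σ K) (F.Term i))) :
    F.degreePart d i v ∈ (J • ⊤ : Submodule (MvPolynomial σ K) (F.Term i)) := by
  rw [mem_smul_top_pi_iff] at hv ⊢
  intro k
  rw [degreePart_apply]
  split_ifs
  · exact homogeneousComponent_mem_of_mem hJ (hv k) _
  · exact zero_mem _

theorem degreePart_mem_boundariesMod {J : Ideal (MvPolynomial σ K)}
    (hJ : J.IsHomogeneous (homogeneousSubmodule σ K)) {d i : ℕ} {v : F.Term i}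
    (hv : v ∈ boundariesMod F.differential J i) :
    F.degreePart d i v ∈ boundariesMod F.differential J i := by
  obtain ⟨y, hy⟩ := mem_boundariesMod_iff.1 hv
  have h := degreePart_mem_smul_top hJ (d := d) hy
  rw [map_sub, degreePart_differential] at h
  exact mem_boundariesMod_iff.2 ⟨_, h⟩

theorem degreePart_X_smul_sub_differential_mem {J : Ideal (MvPolynomial σ K)}
    (hJ : J.IsHomogeneous (homogeneousSubmodule σ K)) {d i : ℕ} {j : σ} {u : F.Term i}
    {v : F.Term (i + 1)} (h : (X j : MvPolynomial σ K) • u - F.differential i v ∈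
      (J • ⊤ : Submodule (MvPolynomial σ K) (F.Term i))) :
    (X j : MvPolynomial σ K) • F.degreePart d i u -
      F.differential i (F.degreePart (d + 1) (i + 1) v) ∈
        (J • ⊤ : Submodule (MvPolynomial σ K) (F.Term i)) := by
  rw [← degreePart_succ_X_smul, ← degreePart_differential, ← map_sub]
  exact degreePart_mem_smul_top hJ h

variable (F) in
theorem subsingleton_fin_rank_zero : Subsingleton (Fin (F.rank 0)) :=
  Fin.subsingleton_iff_le_one.2 F.rank_zero.le

theorem const_mem_boundariesMod_zero_iff {J : Ideal (MvPolynomial σ K)} {p : MvPolynomial σ K} :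
    (fun _ => p) ∈ boundariesMod F.differential J 0 ↔ p ∈ I ⊔ J := by
  have k : Fin (F.rank 0) := ⟨0, F.rank_zero.symm ▸ Nat.one_pos⟩
  have := F.subsingleton_fin_rank_zero
  rw [mem_boundariesMod_iff, Submodule.mem_sup]
  constructor
  · rintro ⟨y, hy⟩
    refine ⟨F.differential 0 y k, (F.exact_zero _).2 ⟨y, ?_⟩, _, mem_smul_top_pi_iff.1 hy k,
      add_sub_cancel _ _⟩
    ext1 l
    rw [Subsingleton.elim l k]
  · rintro ⟨a, ha, b, hb, rfl⟩
    obtain ⟨y, hy⟩ := (F.exact_zero a).1 ha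
    refine ⟨y, mem_smul_top_pi_iff.2 fun l => ?_⟩
    simpa [hy] using hb

theorem cyclesMod_idealOfVars (i : ℕ) :
    cyclesMod F.differential (idealOfVars σ K) i = ⊤ := by
  cases i with
  | zero => rfl
  | succ i =>
    refine eq_top_iff.2 fun v _ => mem_smul_top_pi_iff.2 fun k => ?_
    rw [Matrix.mulVecLin_apply, Matrix.mulVec, dotProduct]
    refine Ideal.sum_mem _ fun l _ => ?_
    exact Ideal.mul_mem_right _ _ (mem_idealOfVars_iff.2 (F.minimal i k l))

theorem mem_boundariesMod_idealOfVars_iff {i : ℕ} {v : F.Term i} :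
    v ∈ boundariesMod F.differential (idealOfVars σ K) i ↔ ∀ k, constantCoeff (v k) = 0 := by
  have h : LinearMap.range (F.differential i) ≤ idealOfVars σ K • ⊤ := by
    rintro _ ⟨y, rfl⟩
    have hy : y ∈ cyclesMod F.differential (idealOfVars σ K) (i + 1) := by
      rw [cyclesMod_idealOfVars]
      trivial
    exact hy
  rw [boundariesMod, sup_eq_right.2 h, mem_smul_top_pi_iff]
  simp only [mem_idealOfVars_iff]

theorem betti_ne_zero_iff {i j : ℕ} : F.betti i j ≠ 0 ↔ ∃ k, F.shift i k = j := by
  simp [betti, Finset.filter_eq_empty_iff]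

theorem rank_eq_betti {i j : ℕ} (h : ∀ j', F.betti i j' ≠ 0 → j' = j) :
    F.rank i = F.betti i j := by
  rw [betti, Finset.filter_true_of_mem fun k _ => h _ (betti_ne_zero_iff.2 ⟨k, rfl⟩),
    Finset.card_univ, Fintype.card_fin]

/-- Dividing out one more variable raises the degree bound of the homology by at most the shift by
one that the connecting map introduces. -/
theorem degreePart_mem_boundariesMod_sup_span_X {J : Ideal (MvPolynomial σ K)} {j : σ}
    (hJ : J.IsHomogeneous (homogeneousSubmodule σ K)) (hj : IsSMulRegular (MvPolynomial σ K ⧸ J)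
      (X j : MvPolynomial σ K)) {d i : ℕ}
    (h₀ : ∀ w ∈ cyclesMod F.differential J i,
      F.degreePart d i w ∈ boundariesMod F.differential J i)
    (h₁ : ∀ w ∈ cyclesMod F.differential J (i + 1),
      F.degreePart (d + 1) (i + 1) w ∈ boundariesMod F.differential J (i + 1))
    {v : F.Term (i + 1)} (hv : v ∈ cyclesMod F.differential (J ⊔ Ideal.span {X j}) (i + 1)) :
    F.degreePart (d + 1) (i + 1) v ∈
      boundariesMod F.differential (J ⊔ Ideal.span {X j}) (i + 1) := by
  obtain ⟨w, hw, hvw⟩ := exists_connecting F.differential_differential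
    (fun i => isSMulRegular_pi_quotient_smul_top hj) hv
  obtain ⟨y, hy⟩ := mem_boundariesMod_iff.1 (h₀ w hw)
  rw [← neg_mem_iff, neg_sub] at hvw
  have hvw' := degreePart_X_smul_sub_differential_mem hJ (d := d) hvw
  rw [← neg_mem_iff, neg_sub] at hvw'
  have h := h₁ _ (sub_smul_mem_cyclesMod hvw' hy)
  rw [map_sub, degreePart_degreePart, degreePart_succ_X_smul] at h
  exact mem_boundariesMod_sup_span_singleton_iff.2 ⟨_, h⟩

end

section

variable {K : Type*} [Field K] {n : ℕ} {I : Ideal (MvPolynomial (Fin (n + 1)) K)}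
  {F : MinimalGradedFreeResolution I}

variable (F) in
theorem isSMulRegular_reversedVars_quotient {k : ℕ} (hk : k ≤ n) (i : ℕ) :
    IsSMulRegular (F.Term i ⧸ (prefixIdeal (reversedVars K n) k • ⊤ :
      Submodule (MvPolynomial (Fin (n + 1)) K) (F.Term i))) (reversedVars K n k) :=
  isSMulRegular_pi_quotient_smul_top (isSMulRegular_reversedVars K hk)

theorem const_mem_boundariesMod_reversedVars_iff {p : MvPolynomial (Fin (n + 1)) K} :
    (fun _ => p) ∈ boundariesMod F.differential (prefixIdeal (reversedVars K n) 1) 0 ↔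
      p ∈ hyperplaneSection I (Fin.last n) := by
  rw [const_mem_boundariesMod_zero_iff, prefixIdeal_reversedVars_one, hyperplaneSection]

theorem exists_eq_const (v : F.Term 0) : ∃ p, v = fun _ => p := by
  have := F.subsingleton_fin_rank_zero
  exact ⟨v ⟨0, F.rank_zero.symm ▸ Nat.one_pos⟩, funext fun l => by
    rw [Subsingleton.elim l]⟩

variable (hreg : IsSMulRegular (MvPolynomial (Fin (n + 1)) K ⧸ I)
  (X (Fin.last n) : MvPolynomial (Fin (n + 1)) K))

include hreg

theorem cyclesMod_reversedVars_le {k i : ℕ} (hk : k ≤ n) (hi : k ≤ i) :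
    cyclesMod F.differential (prefixIdeal (reversedVars K n) (k + 1)) (i + 1) ≤
      boundariesMod F.differential (prefixIdeal (reversedVars K n) (k + 1)) (i + 1) := by
  refine cyclesMod_prefixIdeal_le F.exact_succ
    (fun k hk i => F.isSMulRegular_reversedVars_quotient hk i) ?_ hk hi
  rw [isSMulRegular_quotient_iff_mem_of_smul_mem] at hreg ⊢
  intro v hv
  obtain ⟨p, rfl⟩ := exists_eq_const v
  exact (F.exact_zero p).1 (hreg p ((F.exact_zero _).2 hv))

theorem rank_eq_zero {i : ℕ} (hi : n < i) : F.rank i = 0 := by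
  obtain ⟨i, rfl⟩ := Nat.exists_eq_succ_of_ne_zero (Nat.ne_zero_of_lt hi)
  have h := cyclesMod_reversedVars_le (F := F) hreg le_rfl (Nat.lt_succ_iff.1 hi)
  rw [prefixIdeal_reversedVars_eq_idealOfVars, cyclesMod_idealOfVars] at h
  have h₁ := mem_boundariesMod_idealOfVars_iff.1 (h (Submodule.mem_top (x := 1)))
  by_contra h₀
  simpa using h₁ ⟨0, Nat.pos_of_ne_zero h₀⟩

theorem degreePart_mem_boundariesMod_of_lt {e : ℕ}
    (he : ∀ d, e < d → ∀ p : MvPolynomial (Fin (n + 1)) K, p.IsHomogeneous d →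
      p ∈ hyperplaneSection I (Fin.last n)) {k i d : ℕ} (hk : k ≤ n) (hd : e + i < d)
    {v : F.Term i}
    (hv : v ∈ cyclesMod F.differential (prefixIdeal (reversedVars K n) (k + 1)) i) :
    F.degreePart d i v ∈
      boundariesMod F.differential (prefixIdeal (reversedVars K n) (k + 1)) i := by
  induction k generalizing i d v with
  | zero =>
    cases i with
    | zero =>
      obtain ⟨p, rfl⟩ := exists_eq_const v
      have h : F.degreePart d 0 (fun _ => p) = fun _ => homogeneousComponent d p :=
        funext fun l => degreePart_zero_apply d _ l
      rw [h, zero_add, const_mem_boundariesMod_reversedVars_iff]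
      exact he d hd _ (homogeneousComponent_isHomogeneous d p)
    | succ i =>
      exact degreePart_mem_boundariesMod (isHomogeneous_prefixIdeal_reversedVars K n _)
        (cyclesMod_reversedVars_le hreg hk (Nat.zero_le i) hv)
  | succ k ih =>
    rw [prefixIdeal_succ _ (k + 1)] at hv ⊢
    cases i with
    | zero => exact boundariesMod_mono le_sup_left (ih (by omega) hd trivial)
    | succ i =>
      obtain ⟨d, rfl⟩ := Nat.exists_eq_succ_of_ne_zero (Nat.ne_zero_of_lt hd)
      exact degreePart_mem_boundariesMod_sup_span_X (isHomogeneous_prefixIdeal_reversedVars K n _)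
        (isSMulRegular_reversedVars K hk) (fun w hw => ih (by omega) (by omega) hw)
        (fun w hw => ih (by omega) (by omega) hw) hv

theorem shift_le {e : ℕ} (he : ∀ d, e < d → ∀ p : MvPolynomial (Fin (n + 1)) K,
      p.IsHomogeneous d → p ∈ hyperplaneSection I (Fin.last n)) (i : ℕ) (k : Fin (F.rank i)) :
    F.shift i k ≤ e + i := by
  by_contra! h
  have h₁ : F.degreePart (F.shift i k) i 1 ∈ boundariesMod F.differential (idealOfVars _ K) i := by
    rw [← prefixIdeal_reversedVars_eq_idealOfVars]
    refine degreePart_mem_boundariesMod_of_lt hreg he le_rfl h ?_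
    rw [prefixIdeal_reversedVars_eq_idealOfVars, cyclesMod_idealOfVars]
    trivial
  simpa [degreePart_apply] using mem_boundariesMod_idealOfVars_iff.1 h₁ k

theorem exists_connectingChain {p : MvPolynomial (Fin (n + 1)) K}
    (hp : p ∈ socleLift (hyperplaneSection I (Fin.last n))) :
    ∃ u ∈ connectingChains F.differential (reversedVars K n) n, u 0 = fun _ => p := by
  obtain ⟨u, hu, hu₀, -⟩ := exists_mem_connectingChains (v := fun _ => p)
    (fun k hk => cyclesMod_reversedVars_le (F := F) hreg hk.le le_rfl) fun j =>
      const_mem_boundariesMod_reversedVars_iff.2 (mem_socleLift_iff.1 hp _)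
  exact ⟨u, hu, hu₀⟩

omit hreg in
theorem mem_hyperplaneSection_of_mem_connectingChains {u : ∀ k, F.Term k}
    {p : MvPolynomial (Fin (n + 1)) K} (hu₀ : u 0 = fun _ => p)
    (hu : u ∈ connectingChains F.differential (reversedVars K n) n)
    (hun : ∀ k, constantCoeff (u n k) = 0) : p ∈ hyperplaneSection I (Fin.last n) := by
  have h := apply_zero_mem_boundariesMod_of_mem_connectingChains F.differential_differential
    (fun k hk i => F.isSMulRegular_reversedVars_quotient hk i) hu (by
      rwa [prefixIdeal_reversedVars_eq_idealOfVars, mem_boundariesMod_idealOfVars_iff])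
  rwa [hu₀, const_mem_boundariesMod_reversedVars_iff] at h

theorem socleAtMostOneDimensional (hrank : F.rank n ≤ 1) :
    SocleAtMostOneDimensional (hyperplaneSection I (Fin.last n)) := by
  intro p hp q hq hqJ
  have := Fin.subsingleton_iff_le_one.2 hrank
  obtain ⟨u, hu, hu₀⟩ := exists_connectingChain (F := F) hreg hp
  obtain ⟨v, hv, hv₀⟩ := exists_connectingChain (F := F) hreg hq
  obtain ⟨k, hk⟩ : ∃ k, constantCoeff (v n k) ≠ 0 := by
    by_contra! h
    exact hqJ (mem_hyperplaneSection_of_mem_connectingChains hv₀ hv h)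
  set c := constantCoeff (u n k) / constantCoeff (v n k)
  refine ⟨c, mem_hyperplaneSection_of_mem_connectingChains (u := u - (C c : MvPolynomial _ K) • v)
    ?_ (sub_mem hu (Submodule.smul_mem _ _ hv)) fun l => ?_⟩
  · simp only [Pi.sub_apply, Pi.smul_apply, hu₀, hv₀]
    rfl
  · simp [Subsingleton.elim l k, c, hk]

theorem exists_shift_eq {e : ℕ} {p : MvPolynomial (Fin (n + 1)) K} (hhom : p.IsHomogeneous e)
    (hp : p ∈ socleLift (hyperplaneSection I (Fin.last n)))
    (hpJ : p ∉ hyperplaneSection I (Fin.last n)) : ∃ l, F.shift n l = e + n := by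
  obtain ⟨u, hu, hu₀⟩ := exists_connectingChain (F := F) hreg hp
  by_contra! h
  refine hpJ (mem_hyperplaneSection_of_mem_connectingChains
    (u := fun k => F.degreePart (e + k) k (u k)) ?_ ?_ fun l => ?_)
  · ext1 l
    simp only [degreePart_zero_apply, hu₀, add_zero, homogeneousComponent_eq_self hhom]
  · exact mem_connectingChains_iff.2 fun k hk => degreePart_X_smul_sub_differential_mem
      (isHomogeneous_prefixIdeal_reversedVars K n _) (mem_connectingChains_iff.1 hu k hk)
  · have := h l
    rw [degreePart_apply]
    split_ifs
    · rw [constantCoeff_eq, coeff_homogeneousComponent, if_neg (by rw [map_zero]; omega)]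
    · exact map_zero _

end

end MinimalGradedFreeResolution

section Gorenstein

variable {K : Type*} [Field K] {n : ℕ} {I : Ideal (MvPolynomial (Fin (n + 1)) K)}

theorem IsGorensteinIdeal.socleAtMostOneDimensional (hG : IsGorensteinIdeal I)
    (hreg : IsSMulRegular (MvPolynomial (Fin (n + 1)) K ⧸ I)
      (X (Fin.last n) : MvPolynomial (Fin (n + 1)) K)) :
    SocleAtMostOneDimensional (hyperplaneSection I (Fin.last n)) := by
  obtain ⟨F, j, hj, hj'⟩ := hG
  refine F.socleAtMostOneDimensional hreg ?_
  have hrank : F.rank F.length = 1 := (F.rank_eq_betti hj').trans hj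
  rcases lt_trichotomy F.length n with h | h | h
  · exact (F.rank_eq_zero_of_length_lt n h).trans_le zero_le_one
  · exact ((congrArg F.rank h.symm).trans hrank).le
  · exact absurd (F.rank_eq_zero hreg h) F.rank_length_ne_zero

theorem MinimalGradedFreeResolution.quotientRegularity_eq (F : MinimalGradedFreeResolution I)
    (hreg : IsSMulRegular (MvPolynomial (Fin (n + 1)) K ⧸ I)
      (X (Fin.last n) : MvPolynomial (Fin (n + 1)) K)) {e : ℕ}
    (he : ∀ d, e < d → ∀ p : MvPolynomial (Fin (n + 1)) K, p.IsHomogeneous d →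
      p ∈ hyperplaneSection I (Fin.last n))
    {p : MvPolynomial (Fin (n + 1)) K} (hhom : p.IsHomogeneous e)
    (hp : p ∉ hyperplaneSection I (Fin.last n)) : quotientRegularity I = e := by
  have hsocle : p ∈ socleLift (hyperplaneSection I (Fin.last n)) :=
    mem_socleLift_iff.2 fun i => he (1 + e) (by omega) _ ((isHomogeneous_X K i).mul hhom)
  obtain ⟨l, hl⟩ := F.exists_shift_eq hreg hhom hsocle hp
  refine IsGreatest.csSup_eq ⟨⟨F, n, e + n, F.betti_ne_zero_iff.2 ⟨l, hl⟩, rfl⟩, ?_⟩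
  rintro r ⟨F', i, j, hb, rfl⟩
  obtain ⟨k, hk⟩ := F'.betti_ne_zero_iff.1 hb
  have := F'.shift_le hreg he i k
  omega

end Gorenstein

section VanishingIdeal

attribute [local instance] MvPolynomial.gradedAlgebra

variable {σ K ι : Type*} [Field K] {P : ι → σ → K}

theorem eval_eq_zero_of_mem_gradedVanishingIdeal {f : MvPolynomial σ K}
    (hf : f ∈ gradedVanishingIdeal P) (i : ι) : eval (P i) f = 0 := by
  have h : gradedVanishingIdeal P ≤ RingHom.ker (eval (P i)) := Ideal.span_le.2 fun g hg => hg.2 i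
  exact h hf

theorem mem_gradedVanishingIdeal_iff {f : MvPolynomial σ K} {d : ℕ} (hf : f.IsHomogeneous d) :
    f ∈ gradedVanishingIdeal P ↔ ∀ i, eval (P i) f = 0 :=
  ⟨eval_eq_zero_of_mem_gradedVanishingIdeal, fun h => Ideal.subset_span ⟨⟨d, hf⟩, h⟩⟩

variable (P) in
theorem isHomogeneous_gradedVanishingIdeal :
    (gradedVanishingIdeal P).IsHomogeneous (homogeneousSubmodule σ K) :=
  Ideal.homogeneous_span _ _ fun _ hg => hg.1

theorem eval_eq_of_sub_X_mul_mem {f q : MvPolynomial σ K} {j : σ}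
    (h : f - X j * q ∈ gradedVanishingIdeal P) (i : ι) :
    eval (P i) f = P i j * eval (P i) q := by
  have h := eval_eq_zero_of_mem_gradedVanishingIdeal h i
  rwa [map_sub, map_mul, eval_X, sub_eq_zero] at h

namespace IsIndicatorFunction

variable {i : ι} {f : MvPolynomial σ K}

theorem mul_eval_eq_zero_iff (hf : IsIndicatorFunction P i f) {q : MvPolynomial σ K} :
    (∀ l, eval (P l) (q * f) = 0) ↔ eval (P i) q = 0 := by
  simp only [map_mul, mul_eq_zero]
  refine ⟨fun h => (h i).resolve_right hf.2.1, fun h l => ?_⟩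
  rcases eq_or_ne l i with rfl | hl
  · exact Or.inl h
  · exact Or.inr (hf.2.2 l hl)

theorem colon_eq (hf : IsIndicatorFunction P i f) :
    (gradedVanishingIdeal P).colon {f} = pointIdeal (P i) := by
  obtain ⟨d, hd⟩ := hf.1
  apply le_antisymm
  · intro q hq
    rw [Submodule.mem_colon_singleton, smul_eq_mul] at hq
    rw [← sum_homogeneousComponent q]
    refine Ideal.sum_mem _ fun k _ => ?_
    have hk := homogeneousComponent_isHomogeneous k q
    rw [pointIdeal, mem_gradedVanishingIdeal_iff hk, forall_const, ← hf.mul_eval_eq_zero_iff,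
      ← mem_gradedVanishingIdeal_iff (hk.mul hd)]
    have h := homogeneousComponent_mem_of_mem (isHomogeneous_gradedVanishingIdeal P) hq (d + k)
    rwa [mul_comm, homogeneousComponent_mul_left_of_le hd (Nat.le_add_right d k),
      Nat.add_sub_cancel_left, mul_comm] at h
  · refine Ideal.span_le.2 ?_
    rintro q ⟨⟨k, hk⟩, hq⟩
    rw [SetLike.mem_coe, Submodule.mem_colon_singleton, smul_eq_mul,
      mem_gradedVanishingIdeal_iff (hk.mul hd), hf.mul_eval_eq_zero_iff]
    exact hq ()

theorem vNumber_le (hf : IsIndicatorFunction P i f) {d : ℕ} (hd : f.IsHomogeneous d) :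
    vNumber (gradedVanishingIdeal P) (pointIdeal (P i)) ≤ d :=
  Nat.sInf_le ⟨f, hd, hf.colon_eq⟩

theorem coordinate_ne_zero (hf : IsIndicatorFunction P i f) {j : σ}
    (hj : IsSMulRegular (MvPolynomial σ K ⧸ gradedVanishingIdeal P) (X j : MvPolynomial σ K)) :
    P i j ≠ 0 := by
  intro h
  obtain ⟨d, hd⟩ := hf.1
  have hXf : X j * f ∈ gradedVanishingIdeal P := by
    rw [mem_gradedVanishingIdeal_iff ((isHomogeneous_X K j).mul hd), hf.mul_eval_eq_zero_iff,
      eval_X, h]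
  have hfI := (isSMulRegular_quotient_iff_mem_of_smul_mem _ _).1 hj f hXf
  exact hf.2.1 (eval_eq_zero_of_mem_gradedVanishingIdeal hfI i)

theorem degree_ne_zero (hf : IsIndicatorFunction P i f) {l : ι} (hl : l ≠ i) {d : ℕ}
    (hd : f.IsHomogeneous d) : d ≠ 0 := by
  rintro rfl
  have hC := homogeneousComponent_eq_self hd
  rw [homogeneousComponent_zero] at hC
  have hi := hf.2.1
  have hl := hf.2.2 l hl
  rw [← hC, eval_C] at hi hl
  exact hi hl

theorem notMem_hyperplaneSection (hf : IsIndicatorFunction P i f)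
    (hd : f.IsHomogeneous (vNumber (gradedVanishingIdeal P) (pointIdeal (P i)))) {j : σ}
    (hj : ∀ l, P l j ≠ 0) : f ∉ hyperplaneSection (gradedVanishingIdeal P) j := by
  intro h
  obtain ⟨q, hq⟩ := exists_homogeneous_of_mem_hyperplaneSection
    (isHomogeneous_gradedVanishingIdeal P) hd h
  have heval := eval_eq_of_sub_X_mul_mem hq.2
  rcases hq.1 with rfl | ⟨d, hdv, hqd⟩
  · exact hf.2.1 (by rw [heval, map_zero, mul_zero])
  · have hqi : IsIndicatorFunction P i q := by
      refine ⟨⟨d, hqd⟩, right_ne_zero_of_mul (heval i ▸ hf.2.1), fun l hl => ?_⟩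
      exact (mul_eq_zero.1 (heval l ▸ hf.2.2 l hl)).resolve_left (hj l)
    have := hqi.vNumber_le hqd
    omega

/-- The form `P_{i,j} t_k - P_{i,k} t_j` vanishes at `[P_i]`, so its product with `f` is in `I`. -/
theorem mem_socleLift_hyperplaneSection (hf : IsIndicatorFunction P i f) {j : σ}
    (hj : P i j ≠ 0) : f ∈ socleLift (hyperplaneSection (gradedVanishingIdeal P) j) := by
  refine mem_socleLift_iff.2 fun k => mem_hyperplaneSection_iff.2 ⟨C (P i k / P i j) * f, ?_⟩
  obtain ⟨d, hd⟩ := hf.1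
  have hform : (X k - C (P i k / P i j) * X j).IsHomogeneous 1 :=
    (isHomogeneous_X K k).sub (isHomogeneous_C_mul_X _ j)
  rw [mul_left_comm, ← mul_assoc, ← sub_mul, mem_gradedVanishingIdeal_iff (hform.mul hd),
    hf.mul_eval_eq_zero_iff]
  simp [hj]

end IsIndicatorFunction

/-- The combination of the polynomials `f i` that takes the value `x i` at `P i`, provided that
`f i` is an indicator function of `[P i]`. -/
noncomputable def interpolant [Fintype ι] (P : ι → σ → K) (f : ι → MvPolynomial σ K) (x : ι → K) :
    MvPolynomial σ K :=
  ∑ i, C (x i / eval (P i) (f i)) * f i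

section Interpolation

variable [Fintype ι] {f : ι → MvPolynomial σ K}

theorem eval_interpolant (hf : ∀ i, IsIndicatorFunction P i (f i)) (x : ι → K) (l : ι) :
    eval (P l) (interpolant P f x) = x l := by
  rw [interpolant, map_sum, Finset.sum_eq_single l]
  · rw [map_mul, eval_C, div_mul_cancel₀ _ (hf l).2.1]
  · intro i _ hil
    rw [map_mul, (hf i).2.2 l hil.symm, mul_zero]
  · simp

theorem isHomogeneous_interpolant {d : ℕ} (hd : ∀ i, (f i).IsHomogeneous d) (x : ι → K) :
    (interpolant P f x).IsHomogeneous d :=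
  IsHomogeneous.sum _ _ _ fun i _ => (hd i).C_mul _

theorem mem_reedMullerCode_iff (hf : ∀ i, IsIndicatorFunction P i (f i)) {d : ℕ}
    (hd : ∀ i, (f i).IsHomogeneous (d + 1)) {j : σ} (hj : ∀ i, P i j = 1) {x : ι → K} :
    x ∈ reedMullerCode P d ↔
      interpolant P f x ∈ hyperplaneSection (gradedVanishingIdeal P) j := by
  have hx := isHomogeneous_interpolant (P := P) hd x
  constructor
  · rintro ⟨p, hp, rfl⟩
    have hXp : (X j * p).IsHomogeneous (d + 1) := add_comm 1 d ▸ (isHomogeneous_X K j).mul hp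
    rw [mem_hyperplaneSection_iff]
    refine ⟨p, (mem_gradedVanishingIdeal_iff (hx.sub hXp)).2 fun i => ?_⟩
    rw [map_sub, eval_interpolant hf, map_mul, eval_X, hj, one_mul]
    exact sub_self _
  · intro h
    obtain ⟨q, hq, hqI⟩ := exists_homogeneous_of_mem_hyperplaneSection
      (isHomogeneous_gradedVanishingIdeal P) hx h
    refine ⟨q, ?_, funext fun i => ?_⟩
    · rcases hq with rfl | ⟨e, he, hqe⟩
      · exact zero_mem _
      · exact Nat.succ_injective he ▸ hqe
    · have hqi := eval_eq_of_sub_X_mul_mem hqI i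
      rw [eval_interpolant hf, hj, one_mul] at hqi
      exact hqi.symm

end Interpolation

theorem mem_hyperplaneSection_of_lt [Finite ι] {f : ι → MvPolynomial σ K}
    (hf : ∀ i, IsIndicatorFunction P i (f i)) {e : ℕ}
    (he : ∀ i, (f i).IsHomogeneous e) {j : σ} (hj : ∀ i, P i j ≠ 0) {d : ℕ} (hd : e < d)
    {p : MvPolynomial σ K} (hp : p.IsHomogeneous d) :
    p ∈ hyperplaneSection (gradedVanishingIdeal P) j := by
  have := Fintype.ofFinite ι
  obtain ⟨k, rfl⟩ := Nat.exists_eq_add_of_lt hd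
  refine mem_hyperplaneSection_iff.2
    ⟨X j ^ k * interpolant P f fun i => eval (P i) p / P i j ^ (k + 1), ?_⟩
  have hq := (isHomogeneous_X_pow (R := K) j (k + 1)).mul (isHomogeneous_interpolant (P := P) he
    fun i => eval (P i) p / P i j ^ (k + 1))
  rw [show k + 1 + e = e + k + 1 by omega] at hq
  rw [← mul_assoc, ← pow_succ', mem_gradedVanishingIdeal_iff (hp.sub hq)]
  intro i
  rw [map_sub, map_mul, map_pow, eval_X, eval_interpolant hf,
    mul_div_cancel₀ _ (pow_ne_zero _ (hj i)), sub_self]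

end VanishingIdeal

section StandardMonomials

theorem support_subset_footprint {σ K : Type*} [Field K] {ord : MonomialOrder σ}
    {I : Ideal (MvPolynomial σ K)} {f : MvPolynomial σ K} (hf : f ∈ footprintSpan ord I) :
    ↑f.support ⊆ footprint ord I := by
  rwa [footprintSpan, ← restrictSupport_eq_span, mem_restrictSupport_iff] at hf

theorem degree_notMem_footprint {σ K : Type*} [Field K] {ord : MonomialOrder σ}
    {I : Ideal (MvPolynomial σ K)} {f : MvPolynomial σ K} (hf : f ∈ I) (h₀ : f ≠ 0) :
    ord.degree f ∉ footprint ord I :=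
  fun h => h (Ideal.subset_span ⟨f, hf, h₀, rfl⟩)

theorem support_subset_footprintDegree {σ K : Type*} [Field K] {ord : MonomialOrder σ}
    {I : Ideal (MvPolynomial σ K)} {f : MvPolynomial σ K} (hf : f ∈ footprintSpan ord I) {d : ℕ}
    (hd : f.IsHomogeneous d) : ↑f.support ⊆ footprintDegree ord I d :=
  fun _ ha => ⟨support_subset_footprint hf ha, (hd.degree_eq_sum_deg_support ha).symm⟩

section GRevLex

attribute [local instance] MvPolynomial.gradedAlgebra

variable {K : Type*} [Field K] {n : ℕ}

theorem grevLex_lt_of_last {a b : Fin (n + 1) →₀ ℕ} (hdeg : a.degree = b.degree)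
    (ha : a (Fin.last n) ≠ 0) (hb : b (Fin.last n) = 0) :
    (MonomialOrder.grevLex n).toSyn a < (MonomialOrder.grevLex n).toSyn b :=
  MonomialOrder.grevLex_lt_iff.2 (Or.inr ⟨hdeg, Fin.last n,
    fun j hj => absurd hj (Fin.le_last j).not_gt, by omega⟩)

theorem degree_grevLex_last_eq_zero {p : MvPolynomial (Fin (n + 1)) K} {d : ℕ}
    (hp : p.IsHomogeneous d) {a : Fin (n + 1) →₀ ℕ} (ha : a ∈ p.support)
    (ha₀ : a (Fin.last n) = 0) : (MonomialOrder.grevLex n).degree p (Fin.last n) = 0 := by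
  by_contra h
  have hp₀ : p ≠ 0 := support_nonempty.1 ⟨a, ha⟩
  have hlead := MonomialOrder.degree_mem_support (m := MonomialOrder.grevLex n) hp₀
  have hdeg := (hp.degree_eq_sum_deg_support hlead).symm.trans (hp.degree_eq_sum_deg_support ha)
  exact (grevLex_lt_of_last hdeg h ha₀).not_ge (MonomialOrder.le_degree ha)

theorem leadingCoeff_grevLex_eq {a : Fin (n + 1) →₀ ℕ} {p : MvPolynomial (Fin (n + 1)) K} {d : ℕ}
    (hp : p.IsHomogeneous d) (ha : a ∈ p.support) (ha₀ : a (Fin.last n) = 0)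
    (h : ∀ b ∈ p.support, b (Fin.last n) = 0 → b = a) :
    (MonomialOrder.grevLex n).leadingCoeff p = coeff a p := by
  have hp₀ : p ≠ 0 := support_nonempty.1 ⟨a, ha⟩
  rw [MonomialOrder.leadingCoeff, h _ (MonomialOrder.degree_mem_support hp₀)
    (degree_grevLex_last_eq_zero hp ha ha₀)]

variable {I : Ideal (MvPolynomial (Fin (n + 1)) K)}

/-- Any element of `I` congruent to `p` modulo `t_s` has the same `t_s`-free monomials as `p`, and
its GRevLex leading monomial is one of them. -/
theorem eq_zero_of_mem_hyperplaneSection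
    (hI : I.IsHomogeneous (homogeneousSubmodule (Fin (n + 1)) K))
    {p : MvPolynomial (Fin (n + 1)) K} {d : ℕ} (hp : p.IsHomogeneous d)
    (hfoot : ↑p.support ⊆ footprint (MonomialOrder.grevLex n) I)
    (hlast : ∀ a ∈ p.support, a (Fin.last n) = 0)
    (h : p ∈ hyperplaneSection I (Fin.last n)) : p = 0 := by
  by_contra hp₀
  obtain ⟨q, hq⟩ := mem_hyperplaneSection_iff.1 h
  set g := homogeneousComponent d (p - X (Fin.last n) * q)
  have hg : g ∈ I := homogeneousComponent_mem_of_mem hI hq d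
  have hcoeff : ∀ a : Fin (n + 1) →₀ ℕ, a (Fin.last n) = 0 → coeff a g = coeff a p := by
    intro a ha
    have hXq : coeff a (X (Fin.last n) * q) = 0 := by
      rw [coeff_X_mul', if_neg (Finsupp.notMem_support_iff.2 ha)]
    rw [coeff_homogeneousComponent, coeff_sub, hXq, sub_zero, ite_eq_left_iff]
    exact fun had => (hp.coeff_eq_zero had).symm
  obtain ⟨c, hc⟩ := support_nonempty.2 hp₀
  have hcg : c ∈ g.support := by rwa [mem_support_iff, hcoeff c (hlast c hc), ← mem_support_iff]
  have hg₀ : g ≠ 0 := support_nonempty.1 ⟨c, hcg⟩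
  refine degree_notMem_footprint hg hg₀ (hfoot (a := (MonomialOrder.grevLex n).degree g) ?_)
  rw [Finset.mem_coe, mem_support_iff, ← hcoeff _ (degree_grevLex_last_eq_zero
    (homogeneousComponent_isHomogeneous _ _) hcg (hlast c hc)), ← mem_support_iff]
  exact MonomialOrder.degree_mem_support hg₀

theorem monomial_notMem_hyperplaneSection
    (hI : I.IsHomogeneous (homogeneousSubmodule (Fin (n + 1)) K)) {a : Fin (n + 1) →₀ ℕ}
    (ha : a ∈ footprint (MonomialOrder.grevLex n) I) (ha₀ : a (Fin.last n) = 0) :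
    monomial a (1 : K) ∉ hyperplaneSection I (Fin.last n) := by
  classical
  intro h
  have := eq_zero_of_mem_hyperplaneSection hI (isHomogeneous_monomial 1 rfl)
    (by simpa [support_monomial] using ha) (by simpa [support_monomial] using ha₀) h
  simp at this

theorem eq_of_mem_footprintDegree (hI : I.IsHomogeneous (homogeneousSubmodule (Fin (n + 1)) K))
    (hsoc : SocleAtMostOneDimensional (hyperplaneSection I (Fin.last n))) {e : ℕ}
    (he : ∀ d, e < d → ∀ p : MvPolynomial (Fin (n + 1)) K, p.IsHomogeneous d →
      p ∈ hyperplaneSection I (Fin.last n)) {a b : Fin (n + 1) →₀ ℕ}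
    (ha : a ∈ footprintDegree (MonomialOrder.grevLex n) I e)
    (hb : b ∈ footprintDegree (MonomialOrder.grevLex n) I e)
    (ha₀ : a (Fin.last n) = 0) (hb₀ : b (Fin.last n) = 0) : a = b := by
  classical
  have hsocle : ∀ c : Fin (n + 1) →₀ ℕ, c.degree = e →
      monomial c (1 : K) ∈ socleLift (hyperplaneSection I (Fin.last n)) := fun c hc =>
    mem_socleLift_iff.2 fun k => he (1 + e) (by omega) _
      ((isHomogeneous_X K k).mul (isHomogeneous_monomial 1 hc))
  obtain ⟨r, hr⟩ := hsoc _ (hsocle a ha.2) _ (hsocle b hb.2)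
    (monomial_notMem_hyperplaneSection hI hb.1 hb₀)
  rw [C_mul_monomial, mul_one] at hr
  have hsupp : (monomial a (1 : K) - monomial b r).support ⊆ {a, b} :=
    (support_sub _ _ _).trans (Finset.union_subset_union support_monomial_subset
      support_monomial_subset)
  have hzero := eq_zero_of_mem_hyperplaneSection hI
    ((isHomogeneous_monomial 1 ha.2).sub (isHomogeneous_monomial r hb.2))
    (fun c hc => ?_) (fun c hc => ?_) hr
  · by_contra hab
    simpa [coeff_monomial, Ne.symm hab] using congrArg (coeff a) hzero
  · rcases Finset.mem_insert.1 (hsupp hc) with rfl | hc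
    · exact ha.1
    · exact Finset.mem_singleton.1 hc ▸ hb.1
  · rcases Finset.mem_insert.1 (hsupp hc) with rfl | hc
    · exact ha₀
    · exact Finset.mem_singleton.1 hc ▸ hb₀

theorem exists_eq_smul_monomial_add_X_mul {σ : Type*} {j : σ} {a : σ →₀ ℕ}
    {p : MvPolynomial σ K} {d : ℕ} (hp : p.IsHomogeneous (d + 1)) (ha : a.degree = d + 1)
    (h : ∀ b ∈ p.support, b j = 0 → b = a) :
    ∃ q : MvPolynomial σ K, q.IsHomogeneous d ∧ p = coeff a p • monomial a 1 + X j * q := by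
  classical
  have hmem : p - monomial a (coeff a p) ∈ Ideal.span {X j} := by
    refine mem_span_singleton_X_iff.2 fun b hb hb₀ => ?_
    rw [mem_support_iff, coeff_sub, coeff_monomial] at hb
    split_ifs at hb with hab
    · exact hb (by rw [hab, sub_self])
    · exact hab (h b (mem_support_iff.2 (by rwa [sub_zero] at hb)) hb₀).symm
  obtain ⟨q, hq⟩ := Ideal.mem_span_singleton.1 hmem
  refine ⟨homogeneousComponent d q, homogeneousComponent_isHomogeneous d q, ?_⟩
  rw [← homogeneousComponent_succ_X_mul, ← hq, homogeneousComponent_eq_self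
    (hp.sub (isHomogeneous_monomial _ ha)), smul_monomial, smul_eq_mul, mul_one, add_sub_cancel]

theorem exists_common_leading_monomial
    (hI : I.IsHomogeneous (homogeneousSubmodule (Fin (n + 1)) K))
    (hsoc : SocleAtMostOneDimensional (hyperplaneSection I (Fin.last n))) {d : ℕ}
    (hd : ∀ k, d + 1 < k → ∀ p : MvPolynomial (Fin (n + 1)) K, p.IsHomogeneous k →
      p ∈ hyperplaneSection I (Fin.last n)) {f₀ : MvPolynomial (Fin (n + 1)) K}
    (hf₀ : f₀ ∈ footprintSpan (MonomialOrder.grevLex n) I) (hf₀d : f₀.IsHomogeneous (d + 1))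
    (hf₀J : f₀ ∉ hyperplaneSection I (Fin.last n)) :
    ∃ a ∈ footprintDegree (MonomialOrder.grevLex n) I (d + 1), a (Fin.last n) = 0 ∧
      ∀ f ∈ footprintSpan (MonomialOrder.grevLex n) I, f.IsHomogeneous (d + 1) →
        f ∉ hyperplaneSection I (Fin.last n) →
        coeff a f ≠ 0 ∧ (MonomialOrder.grevLex n).leadingCoeff f = coeff a f ∧
          ∃ G : MvPolynomial (Fin (n + 1)) K, G.IsHomogeneous d ∧
            f = coeff a f • monomial a 1 + X (Fin.last n) * G := by
  obtain ⟨a, haf₀, ha₀⟩ := exists_mem_support_of_notMem_hyperplaneSection hf₀J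
  have ha := support_subset_footprintDegree hf₀ hf₀d haf₀
  refine ⟨a, ha, ha₀, fun f hf hfd hfJ => ?_⟩
  have huniq : ∀ b ∈ f.support, b (Fin.last n) = 0 → b = a := fun b hb hb₀ =>
    eq_of_mem_footprintDegree hI hsoc hd (support_subset_footprintDegree hf hfd hb) ha hb₀ ha₀
  obtain ⟨b, hb, hb₀⟩ := exists_mem_support_of_notMem_hyperplaneSection hfJ
  have haf : a ∈ f.support := huniq b hb hb₀ ▸ hb
  exact ⟨mem_support_iff.1 haf, leadingCoeff_grevLex_eq hfd haf ha₀ huniq,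
    exists_eq_smul_monomial_add_X_mul hfd ha.2 huniq⟩

end GRevLex

end StandardMonomials

section GorensteinPoints

attribute [local instance] MvPolynomial.gradedAlgebra

variable {K ι : Type*} [Field K]

section ParityCheck

variable {σ : Type*} [Fintype ι] {P : ι → σ → K} {f : ι → MvPolynomial σ K}
  {J : Ideal (MvPolynomial σ K)} {c : ι → K} {p : MvPolynomial σ K}

theorem interpolant_sub_C_mul_mem (hfp : ∀ i, f i - C (c i) * p ∈ J) (x : ι → K) :
    interpolant P f x - C (∑ i, c i * (eval (P i) (f i))⁻¹ * x i) * p ∈ J := by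
  have h : interpolant P f x - C (∑ i, c i * (eval (P i) (f i))⁻¹ * x i) * p =
      ∑ i, C (x i / eval (P i) (f i)) * (f i - C (c i) * p) := by
    rw [interpolant, map_sum, Finset.sum_mul, ← Finset.sum_sub_distrib]
    refine Finset.sum_congr rfl fun i _ => ?_
    rw [mul_sub, ← mul_assoc, ← C_mul]
    congr 3
    ring
  rw [h]
  exact Ideal.sum_mem _ fun i _ => Ideal.mul_mem_left _ _ (hfp i)

theorem interpolant_mem_iff (hp : p ∉ J) (hfp : ∀ i, f i - C (c i) * p ∈ J) (x : ι → K) :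
    interpolant P f x ∈ J ↔ ∑ i, c i * (eval (P i) (f i))⁻¹ * x i = 0 := by
  have hmod := interpolant_sub_C_mul_mem (P := P) hfp x
  set r := ∑ i, c i * (eval (P i) (f i))⁻¹ * x i
  constructor
  · intro h
    by_contra hr
    exact hp ((J.restrictScalars K).smul_mem_iff hr |>.1
      (smul_eq_C_mul p r ▸ (J.sub_mem_iff_right h).1 hmod))
  · intro hr
    rwa [hr, map_zero, zero_mul, sub_zero] at hmod

theorem isParityCheckMatrix_of_sub_C_mul_mem [Nonempty ι]
    (hf : ∀ i, IsIndicatorFunction P i (f i)) {d : ℕ} (hd : ∀ i, (f i).IsHomogeneous (d + 1))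
    {j : σ} (hj : ∀ i, P i j = 1) (hc : ∀ i, c i ≠ 0)
    (hp : p ∉ hyperplaneSection (gradedVanishingIdeal P) j)
    (hfp : ∀ i, f i - C (c i) * p ∈ hyperplaneSection (gradedVanishingIdeal P) j) :
    IsParityCheckMatrix (Matrix.of fun (_ : Fin 1) i => c i * (eval (P i) (f i))⁻¹)
      (reedMullerCode P d) := by
  refine ⟨linearIndependent_unique_iff.2 fun h => ?_, fun x => ?_⟩
  · obtain ⟨i⟩ := ‹Nonempty ι›
    exact mul_ne_zero (hc i) (inv_ne_zero (hf i).2.1) (congrFun h i)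
  · rw [mem_reedMullerCode_iff hf hd hj, interpolant_mem_iff hp hfp]
    exact ⟨fun h => funext fun _ => h, fun h => congrFun h 0⟩

end ParityCheck

variable {n : ℕ} {P : ι → Fin (n + 1) → K}

theorem vNumber_eq_quotientRegularity [Finite ι] {f : ι → MvPolynomial (Fin (n + 1)) K}
    (hf : ∀ i, IsIndicatorFunction P i (f i))
    (hv : ∀ i, (f i).IsHomogeneous (vNumber (gradedVanishingIdeal P) (pointIdeal (P i))))
    (hreg : IsSMulRegular (MvPolynomial (Fin (n + 1)) K ⧸ gradedVanishingIdeal P)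
      (X (Fin.last n) : MvPolynomial (Fin (n + 1)) K))
    (hG : IsGorensteinIdeal (gradedVanishingIdeal P)) (i : ι) :
    vNumber (gradedVanishingIdeal P) (pointIdeal (P i)) =
      quotientRegularity (gradedVanishingIdeal P) := by
  have hlast : ∀ l, P l (Fin.last n) ≠ 0 := fun l => (hf l).coordinate_ne_zero hreg
  have hJ := isHomogeneous_hyperplaneSection (isHomogeneous_gradedVanishingIdeal P) (Fin.last n)
  have hsocle := fun l => (hf l).mem_socleLift_hyperplaneSection (hlast l)
  have hnotMem := fun l => (hf l).notMem_hyperplaneSection (hv l) hlast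
  have hdeg : ∀ l, (f l).IsHomogeneous
      (vNumber (gradedVanishingIdeal P) (pointIdeal (P i))) := fun l =>
    (hG.socleAtMostOneDimensional hreg).degree_eq hJ (hsocle l) (hv l) (hnotMem l)
      (hsocle i) (hv i) (hnotMem i) ▸ hv l
  obtain ⟨F, -⟩ := hG
  exact (F.quotientRegularity_eq hreg (fun _ hd _ => mem_hyperplaneSection_of_lt hf hdeg hlast hd)
    (hv i) (hnotMem i)).symm

end GorensteinPoints

theorem mainTheorem10_general {K ι : Type*} [Field K] [Fintype ι] [Nontrivial ι] {n : ℕ}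
    (P : ι → Fin (n + 1) → K) (I : Ideal (MvPolynomial (Fin (n + 1)) K))
    (hI : I = gradedVanishingIdeal P) (r₀ : ℕ) (hr₀ : r₀ = quotientRegularity I)
    (f : ι → MvPolynomial (Fin (n + 1)) K)
    (hf : ∀ i, IsStandardIndicatorFunction (MonomialOrder.grevLex n) P i (f i))
    (hreg : IsSMulRegular (MvPolynomial (Fin (n + 1)) K ⧸ I)
      (X (Fin.last n) : MvPolynomial (Fin (n + 1)) K))
    (hG : IsGorensteinIdeal I) :
    (∃ a ∈ footprintDegree (MonomialOrder.grevLex n) I r₀,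
      a (Fin.last n) = 0 ∧
      IsEssentialMonomial (MonomialOrder.grevLex n) P a ∧
      ∃ (c : ι → K) (G : ι → MvPolynomial (Fin (n + 1)) K), ∀ i,
        c i ≠ 0 ∧ (G i).IsHomogeneous (r₀ - 1) ∧
        f i = c i • monomial a 1 + X (Fin.last n) * G i ∧
        c i = (MonomialOrder.grevLex n).leadingCoeff (f i)) ∧
    ((∀ i, P i (Fin.last n) = 1) →
      IsParityCheckMatrix
        (Matrix.of fun (_ : Fin 1) i =>
          (MonomialOrder.grevLex n).leadingCoeff (f i) * (eval (P i) (f i))⁻¹)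
        (reedMullerCode P (r₀ - 1))) := by
  subst hI
  have hlast : ∀ i, P i (Fin.last n) ≠ 0 := fun i => (hf i).1.coordinate_ne_zero hreg
  have hv : ∀ i, vNumber (gradedVanishingIdeal P) (pointIdeal (P i)) = r₀ := fun i => hr₀ ▸
    vNumber_eq_quotientRegularity (fun i => (hf i).1) (fun i => (hf i).2.2) hreg hG i
  have hhom : ∀ i, (f i).IsHomogeneous r₀ := fun i => hv i ▸ (hf i).2.2
  have hnotMem : ∀ i g, IsStandardIndicatorFunction (MonomialOrder.grevLex n) P i g →
      g ∉ hyperplaneSection (gradedVanishingIdeal P) (Fin.last n) := fun i g hg =>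
    hg.1.notMem_hyperplaneSection hg.2.2 hlast
  have hI := isHomogeneous_gradedVanishingIdeal P
  obtain ⟨i₀, i₁, h₀₁⟩ := exists_pair_ne ι
  obtain ⟨d, rfl⟩ := Nat.exists_eq_succ_of_ne_zero ((hf i₀).1.degree_ne_zero h₀₁.symm (hhom i₀))
  obtain ⟨a, ha, ha₀, hlead⟩ := exists_common_leading_monomial hI
    (hG.socleAtMostOneDimensional hreg)
    (fun _ hk _ => mem_hyperplaneSection_of_lt (fun i => (hf i).1) hhom hlast hk)
    (hf i₀).2.1 (hhom i₀) (hnotMem i₀ _ (hf i₀))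
  choose hne hlc G hGd hfG using fun i => hlead (f i) (hf i).2.1 (hhom i) (hnotMem i _ (hf i))
  refine ⟨⟨a, ha, ha₀, ⟨ha.1, fun i g hg => ?_⟩, fun i => coeff a (f i), G, fun i =>
    ⟨hne i, hGd i, hfG i, (hlc i).symm⟩⟩, fun hP₁ => ?_⟩
  · exact (hlead g hg.2.1 ((hv i).subst hg.2.2) (hnotMem i g hg)).1
  · simp only [hlc]
    exact isParityCheckMatrix_of_sub_C_mul_mem (fun i => (hf i).1) hhom hP₁ hne
      (monomial_notMem_hyperplaneSection hI ha.1 ha₀) fun i => mem_hyperplaneSection_iff.2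
        ⟨G i, by rw [← smul_eq_C_mul, sub_sub, ← hfG i, sub_self]; exact zero_mem _⟩

theorem mainTheorem10 {K : Type*} [Field K] [Finite K] {n m : ℕ} (hm : 2 ≤ m)
    (P : Fin m → Fin (n + 1) → K) (hP : ∀ i, P i ≠ 0)
    (hdistinct : Function.Injective fun i => Projectivization.mk K (P i) (hP i))
    (I : Ideal (MvPolynomial (Fin (n + 1)) K)) (hI : I = gradedVanishingIdeal P)
    (r₀ : ℕ) (hr₀ : r₀ = quotientRegularity I)
    (f : Fin m → MvPolynomial (Fin (n + 1)) K)
    (hf : ∀ i, IsStandardIndicatorFunction (MonomialOrder.grevLex n) P i (f i))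
    (hreg : IsSMulRegular (MvPolynomial (Fin (n + 1)) K ⧸ I)
      (X (Fin.last n) : MvPolynomial (Fin (n + 1)) K))
    (hG : IsGorensteinIdeal I) :
    (∃ a ∈ footprintDegree (MonomialOrder.grevLex n) I r₀,
      a (Fin.last n) = 0 ∧
      IsEssentialMonomial (MonomialOrder.grevLex n) P a ∧
      ∃ (c : Fin m → K) (G : Fin m → MvPolynomial (Fin (n + 1)) K), ∀ i,
        c i ≠ 0 ∧ (G i).IsHomogeneous (r₀ - 1) ∧
        f i = c i • monomial a 1 + X (Fin.last n) * G i ∧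
        c i = (MonomialOrder.grevLex n).leadingCoeff (f i)) ∧
    ((∀ i, P i (Fin.last n) = 1) →
      IsParityCheckMatrix
        (Matrix.of fun (_ : Fin 1) i =>
          (MonomialOrder.grevLex n).leadingCoeff (f i) * (eval (P i) (f i))⁻¹)
        (reedMullerCode P (r₀ - 1))) :=
  have : Nontrivial (Fin m) := Fin.nontrivial_iff_two_le.2 hm
  mainTheorem10_general P I hI r₀ hr₀ f hf hreg hG
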